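/- Let $\alpha,\lambda\in\mathbb R$ and $\rho^*:=e^{\lambda}\pi/\sqrt e$. Let $0<\rho<\rho^*$ and, for each $n\ge 1$, let $\gamma_n>0$ with $\gamma_n\sim\rho n^{\alpha}$ as $n\to\infty$. For each $n\ge1$ let $N_n$ be a stationary Poisson point process in $\mathbb R^n$ of intensity $\lambda_n=n^{n(\alpha-1)}e^{n\lambda}$ (the data) and let $X_n$ be a stationary and isotropic Poisson hyperplane process in $\mathbb R^n$ of intensity $\gamma_n$, i.e. with intensity measure $\Theta_n(A)=2\gamma_n\int_{S^{n-1}}\int_0^\infty 1\{H(u,\tau)\in A\}\,d\tau\,\sigma(du)$, where $H(u,\tau)=\{x:\langle x,u\rangle=\tau\}$ and $\sigma$ is the uniform probability measure on the sphere. $N_n$ and $X_n$ are independent and both are compatible with a measure preserving flow $(\theta_x)_{x\in\mathbb R^n}$ on the underlying probability space. Let $Z_{0,n}$ be the zero cell, i.e. the cell containing the origin of the tessellation induced by $X_n$, and let $\mathbb P_n^0(A)=\lambda_n^{-1}\,\mathbb E\int_B 1_A\circ\theta_x\,N_n(dx)$, with $B$ of volume one, be the Palm probability of $N_n$, under which there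 is a (typical) data point at the origin. Let $M_n:=\max_{x_i\in N_n\cap Z_{0,n}}|x_i|$ be the farthest distance from the origin of a data point in the zero cell, and let $C_n$ be the event that $Z_{0,n}$ contains a data point other than the typical one at the origin, i.e. that the reduced process $N_n-\delta_0$ satisfies $(N_n-\delta_0)(Z_{0,n})>0$. Let $R>0$. (i) If $R>\frac{\sqrt e}{e^\lambda\sqrt{2\pi}}$, then $\frac{\sqrt\pi}{R\sqrt2}<\rho^*$, and for all $\rho\in\left(\frac{\sqrt\pi}{R\sqrt2},\rho^*\right)$, $$\limsup_{n\to\infty}\frac1n\log\mathbb P_n^0\left(M_n\ge Rn^{\frac32-\alpha}\mid C_n\right)\le\lambda+\tfrac12\log(2\pi e)+\log R-\frac{\sqrt2\rho R}{\sqrt\pi}+\log4 .$$ (ii) Let $\rho_u:=\frac{\sqrt\pi}{R\sqrt2}\max\left(\lambda+\frac12\log(2\pi e)+\log R+\log4,\,1\right)$. If $R$ is such that $\rho_u<\rho^*$, which holds for all $R$ large enough, then for all $\rho\in(\rho_u,\rho^*)$, $\lim_{n\to\infty}\mathbb P_n^0\left(M_n\ge Rn^{\frac32-\alpha}\mid C_n\right)=0$,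 and the convergence is at least exponential of rate $r:=\lambda+\frac12\log(32\pi eR^2)-\frac{\sqrt2\rho R}{\sqrt\pi}<0$, i.e. $\limsup_{n\to\infty}\frac1n\log\mathbb P_n^0\left(M_n\ge Rn^{\frac32-\alpha}\mid C_n\right)\le r$. (iii) For all $0<\rho<\min\left(\frac{\sqrt\pi}{R\sqrt2},\rho^*\right)$, $$\limsup_{n\to\infty}\frac1n\log\mathbb P_n^0\left(M_n\le Rn^{\frac32-\alpha}\mid C_n\right)\le\lambda+\tfrac12\log(2\pi e)+\log R-\frac{\sqrt2\rho R}{\sqrt\pi}+\log4 .$$ (iv) If $R<(4e^\lambda\sqrt{2\pi e})^{-1}$, then for all $\rho\in\left(0,\min\left(\frac{\sqrt\pi}{R\sqrt2},\rho^*\right)\right)$, $\lim_{n\to\infty}\mathbb P_n^0\left(M_n\le Rn^{\frac32-\alpha}\mid C_n\right)=0$, and the convergence is at least exponential of rate $r:=\lambda+\frac12\log(32\pi eR^2)-\frac{\sqrt2\rho R}{\sqrt\pi}<0$, i.e. $\limsup_{n\to\infty}\frac1n\log\mathbb P_n^0\left(M_n\le Rn^{\frac32-\alpha}\mid C_n\right)\le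 r$. -/

import Mathlib

open MeasureTheory ProbabilityTheory Filter Topology Set
open scoped ENNReal RealInnerProductSpace Asymptotics

noncomputable section

namespace PoissonCompression

/-- Euclidean space of dimension `n`. -/
abbrev E (n : ℕ) : Type := EuclideanSpace ℝ (Fin n)

/-! ### Hyperplanes -/

/-- The space of affine hyperplanes `H(u, τ) = {x | ⟪x, u⟫ = τ}` (with `u` a unit vector) of the
`n`-dimensional Euclidean space, as sets of points. -/
def Hyperplane (n : ℕ) : Type :=
  {H : Set (E n) // ∃ (u : Metric.sphere (0 : E n) 1) (τ : ℝ), H = {x | ⟪x, (u : E n)⟫ = τ}}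

namespace Hyperplane

variable {n : ℕ}

/-- The hyperplanes that meet the set `C`. -/
def hit (C : Set (E n)) : Set (Hyperplane n) := {H | (H.1 ∩ C).Nonempty}

/-- The Borel `σ`-algebra of the Fell topology: it is generated by the sets of hyperplanes that
meet a given compact set. -/
instance instMeasurableSpace : MeasurableSpace (Hyperplane n) :=
  MeasurableSpace.generateFrom {A | ∃ C : Set (E n), IsCompact C ∧ A = hit C}

/-- The hyperplane `H(u, τ)`. -/
def ofNormal (p : Metric.sphere (0 : E n) 1 × ℝ) : Hyperplane n :=
  ⟨{x | ⟪x, (p.1 : E n)⟫ = p.2}, p.1, p.2, rfl⟩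

/-- The hyperplane `H - x`. -/
def shift (x : E n) (H : Hyperplane n) : Hyperplane n :=
  ⟨{y | y + x ∈ H.1}, by
    obtain ⟨H, u, τ, rfl⟩ := H
    refine ⟨u, τ - ⟪x, (u : E n)⟫, ?_⟩
    ext y
    simp only [mem_ofPred_eq, inner_add_left]
    constructor <;> intro h <;> linarith⟩

theorem measurable_ofNormal : Measurable (ofNormal (n := n)) := by
  refine measurable_generateFrom ?_
  rintro _ ⟨C, hC, rfl⟩
  have h : ofNormal ⁻¹' hit C =
      (fun q : E n × Metric.sphere (0 : E n) 1 => (q.2, ⟪q.1, (q.2 : E n)⟫)) '' (C ×ˢ univ) := by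
    ext ⟨u, t⟩
    simp only [ofNormal, hit, mem_preimage, mem_image, mem_prod, mem_univ, and_true,
      Prod.exists, Prod.mk.injEq]
    constructor
    · rintro ⟨x, hx, hxC⟩
      exact ⟨x, u, hxC, rfl, hx⟩
    · rintro ⟨x, v, hxC, rfl, hx⟩
      exact ⟨x, hx, hxC⟩
  rw [h]
  have hK : IsCompact (C ×ˢ (univ : Set (Metric.sphere (0 : E n) 1))) := hC.prod isCompact_univ
  exact (hK.image (by fun_prop)).measurableSet

theorem measurable_shift (x : E n) : Measurable (shift x) := by
  refine measurable_generateFrom ?_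
  rintro _ ⟨C, hC, rfl⟩
  refine MeasurableSpace.measurableSet_generateFrom ⟨(fun y => y + x) '' C,
    hC.image (by fun_prop), ?_⟩
  ext H
  simp only [shift, hit, mem_preimage, mem_ofPred_eq]
  constructor
  · rintro ⟨y, hy, hyC⟩
    exact ⟨y + x, hy, y, hyC, rfl⟩
  · rintro ⟨_, hz, y, hyC, rfl⟩
    exact ⟨y, hz, hyC⟩

end Hyperplane

/-- The uniform probability measure on the unit sphere (normalized spherical Lebesgue measure). -/
def sphereUniform (n : ℕ) : Measure (Metric.sphere (0 : E n) 1) :=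
  ((volume : Measure (E n)).toSphere univ)⁻¹ • (volume : Measure (E n)).toSphere

/-- The intensity measure of a stationary and isotropic hyperplane process of intensity `γ`:
`Θ(A) = 2γ ∫_{S^{n-1}} ∫_0^∞ 1{H(u, τ) ∈ A} dτ σ(du)`. -/
def hyperplaneIntensity (n : ℕ) (γ : ℝ) : Measure (Hyperplane n) :=
  ENNReal.ofReal (2 * γ) •
    ((sphereUniform n).prod ((volume : Measure ℝ).restrict (Ioi 0))).map Hyperplane.ofNormal

/-! ### Point processes -/

/-- Counting measures: countable sums of Dirac masses. -/
def IsCountingMeasure {S : Type*} [MeasurableSpace S] (μ : Measure S) : Prop :=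
  ∃ (ι : Type) (_ : Countable ι) (s : ι → S), μ = Measure.sum fun i => Measure.dirac (s i)

/-- `N` is a Poisson process with intensity measure `Θ` under `P`: a random counting measure
whose numbers of points in disjoint sets of finite `Θ`-measure are independent Poisson variables
with parameters the `Θ`-measures of the sets. -/
structure IsPoissonProcess {Ω S : Type*} [MeasurableSpace Ω] [MeasurableSpace S]
    (P : Measure Ω) (N : Ω → Measure S) (Θ : Measure S) : Prop where
  measurable : Measurable N
  counting : ∀ ω, IsCountingMeasure (N ω)
  law : ∀ (k : ℕ) (A : Fin k → Set S) (m : Fin k → ℕ), (∀ i, MeasurableSet (A i)) →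
    Pairwise (Function.onFun Disjoint A) → (∀ i, Θ (A i) ≠ ∞) →
    P {ω | ∀ i, N ω (A i) = m i} =
      ∏ i, ENNReal.ofReal
        ((Θ (A i)).toReal ^ m i / (m i).factorial * Real.exp (-(Θ (A i)).toReal))

/-- A (measurable, measure preserving) flow `θ` on the probability space `(Ω, P)`, indexed by the
translations of the Euclidean space. -/
structure IsStationaryFramework {n : ℕ} {Ω : Type*} [MeasurableSpace Ω] (P : Measure Ω)
    (θ : E n → Ω → Ω) : Prop where
  isProbabilityMeasure : IsProbabilityMeasure P
  measurable : Measurable fun p : E n × Ω => θ p.1 p.2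
  zero : ∀ ω, θ 0 ω = ω
  add : ∀ x y ω, θ (x + y) ω = θ x (θ y ω)
  measurePreserving : ∀ x, MeasurePreserving (θ x) P P

/-- The setting in dimension `n`: on a stationary framework `(Ω, P, θ)`, a stationary Poisson
point process `N` of intensity `ℓ` (the data) and a stationary isotropic Poisson hyperplane process
`X` of intensity `γ`, both locally finite and compatible with the flow, and independent. -/
structure IsCompressionModel {n : ℕ} {Ω : Type*} [MeasurableSpace Ω] (P : Measure Ω)
    (θ : E n → Ω → Ω) (N : Ω → Measure (E n)) (X : Ω → Measure (Hyperplane n)) (ℓ γ : ℝ) :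
    Prop where
  framework : IsStationaryFramework P θ
  data_poisson : IsPoissonProcess P N (ENNReal.ofReal ℓ • volume)
  data_locallyFinite : ∀ ω (C : Set (E n)), IsCompact C → N ω C ≠ ∞
  data_compatible : ∀ x ω, N (θ x ω) = (N ω).map fun y => y - x
  hyperplane_poisson : IsPoissonProcess P X (hyperplaneIntensity n γ)
  hyperplane_locallyFinite : ∀ ω (C : Set (E n)), IsCompact C → X ω (Hyperplane.hit C) ≠ ∞
  hyperplane_compatible : ∀ x ω, X (θ x ω) = (X ω).map (Hyperplane.shift x)
  indep : IndepFun N X P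

/-! ### Palm probability -/

/-- The unit cube, a compact set of volume one. -/
def unitCube (n : ℕ) : Set (E n) := {x | ∀ i, x i ∈ Icc (0 : ℝ) 1}

/-- The Palm probability `P⁰(A) = ℓ⁻¹ 𝔼[∫_B 1_A(θ_x) N(dx)]` of a point process `N` of
intensity `ℓ`, where `B` is the unit cube. -/
def palm {n : ℕ} {Ω : Type*} [MeasurableSpace Ω] (P : Measure Ω) (θ : E n → Ω → Ω)
    (N : Ω → Measure (E n)) (ℓ : ℝ) : Measure Ω :=
  (ENNReal.ofReal ℓ)⁻¹ • P.bind fun ω => ((N ω).restrict (unitCube n)).map fun x => θ x ω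

theorem isCompact_unitCube (n : ℕ) : IsCompact (unitCube n) := by
  have h : unitCube n = (PiLp.homeomorph 2 (fun _ : Fin n => ℝ)) ⁻¹'
      (Set.pi univ fun _ => Icc (0 : ℝ) 1) := by
    ext x
    simp [unitCube, PiLp.homeomorph, Pi.le_def, forall_and]
  rw [h]
  exact (Homeomorph.isCompact_preimage _).2 (isCompact_univ_pi fun _ => isCompact_Icc)

/-- The defining formula of the Palm probability, for measurable events. -/
theorem palm_apply {n : ℕ} {Ω : Type*} [MeasurableSpace Ω] {P : Measure Ω}
    {θ : E n → Ω → Ω} {N : Ω → Measure (E n)} {X : Ω → Measure (Hyperplane n)} {ℓ γ : ℝ}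
    (h : IsCompressionModel P θ N X ℓ γ) {A : Set Ω} (hA : MeasurableSet A) :
    palm P θ N ℓ A = (ENNReal.ofReal ℓ)⁻¹ *
      ∫⁻ ω, (∫⁻ x in unitCube n, A.indicator 1 (θ x ω) ∂(N ω)) ∂P := by
  have hθ : ∀ ω, Measurable fun x => θ x ω := fun ω =>
    h.framework.measurable.comp (measurable_id.prodMk measurable_const)
  have hB : MeasurableSet (unitCube n) := (isCompact_unitCube n).measurableSet
  have key : ∀ {A : Set Ω} (ω : Ω), MeasurableSet A →
      (((N ω).restrict (unitCube n)).map fun x => θ x ω) A =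
        (N ω).restrict (unitCube n) {x | θ x ω ∈ A} := fun ω hA =>
    Measure.map_apply (hθ ω) hA
  have hm : Measurable fun ω => ((N ω).restrict (unitCube n)).map fun x => θ x ω := by
    refine Measure.measurable_of_measurable_coe _ fun A hA => ?_
    simp only [key _ hA]
    let κ : Kernel Ω (E n) := Kernel.restrict ⟨N, h.data_poisson.measurable⟩ hB
    exact Kernel.measurable_kernel_prodMk_left_of_finite (κ := κ)
      (t := {p : Ω × E n | θ p.2 p.1 ∈ A})
      (h.framework.measurable.comp (measurable_snd.prodMk measurable_fst) hA)
      (fun ω => ⟨by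
        simpa [κ, Kernel.restrict_apply] using (h.data_locallyFinite ω _ (isCompact_unitCube n)).lt_top⟩)
  rw [palm, Measure.smul_apply, Measure.bind_apply hA hm.aemeasurable, smul_eq_mul]
  congr 1
  refine lintegral_congr fun ω => ?_
  rw [key ω hA]
  exact (lintegral_indicator_one (hθ ω hA)).symm

/-! ### The zero cell and the data in it -/

/-- The points (atoms) of a counting measure. -/
def points {S : Type*} [MeasurableSpace S] (μ : Measure S) : Set S := {x | μ {x} ≠ 0}

/-- The zero cell of the tessellation induced by the hyperplanes of `μ`: the closure of the
connected component, in the complement of the union of these hyperplanes, that contains the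
origin. -/
def zeroCell {n : ℕ} (μ : Measure (Hyperplane n)) : Set (E n) :=
  closure (connectedComponentIn (⋃ H ∈ points μ, H.1)ᶜ 0)

/-- The farthest distance `max |x_i|` from the origin to a data point `x_i` in the zero cell. -/
def farthest {n : ℕ} (ν : Measure (E n)) (μ : Measure (Hyperplane n)) : ℝ≥0∞ :=
  ⨆ x ∈ points ν ∩ zeroCell μ, ENNReal.ofReal ‖x‖

/-- The event that the zero cell contains a data point other than the typical data point, which
sits at the origin under the Palm probability. -/
def otherDataInZeroCell {n : ℕ} {Ω : Type*} (N : Ω → Measure (E n))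
    (X : Ω → Measure (Hyperplane n)) : Set Ω :=
  {ω | 0 < N ω (zeroCell (X ω) \ {0})}

/-- The Palm probability that the farthest data point of the zero cell is at distance at least `r`,
given that the zero cell contains a data point other than the typical one. -/
def probFar {n : ℕ} {Ω : Type*} [MeasurableSpace Ω] (P : Measure Ω) (θ : E n → Ω → Ω)
    (N : Ω → Measure (E n)) (X : Ω → Measure (Hyperplane n)) (ℓ r : ℝ) : ℝ≥0∞ :=
  (palm P θ N ℓ)[{ω | ENNReal.ofReal r ≤ farthest (N ω) (X ω)} | otherDataInZeroCell N X]

/-- The Palm probability that the farthest data point of the zero cell is at distance at most `r`,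
given that the zero cell contains a data point other than the typical one. -/
def probNear {n : ℕ} {Ω : Type*} [MeasurableSpace Ω] (P : Measure Ω) (θ : E n → Ω → Ω)
    (N : Ω → Measure (E n)) (X : Ω → Measure (Hyperplane n)) (ℓ r : ℝ) : ℝ≥0∞ :=
  (palm P θ N ℓ)[{ω | farthest (N ω) (X ω) ≤ ENNReal.ofReal r} | otherDataInZeroCell N X]

/-- The intensity `n^{n(α-1)} e^{nλ}` of the data in dimension `n`. -/
def dataIntensity (α lam : ℝ) (n : ℕ) : ℝ :=
  (n : ℝ) ^ ((n : ℝ) * (α - 1)) * Real.exp (n * lam)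

/-- The exponential growth rate `limsup_n (1/n) log p_n`, an extended real (`log 0 = -∞`). -/
def expRate (p : ℕ → ℝ≥0∞) : EReal :=
  limsup (fun n : ℕ => ENNReal.log (p n) / (n : EReal)) atTop

/-- The critical value `ρ* = e^λ π / √e`. -/
def rhoStar (lam : ℝ) : ℝ := Real.exp lam * Real.pi / √(Real.exp 1)

/-- The threshold
`ρ_u = (√π / (R √2)) max(λ + (1/2) log(2πe) + log R + log 4, 1)`. -/
def rhoUpper (lam R : ℝ) : ℝ :=
  √Real.pi / (R * √2) *
    max (lam + 1 / 2 * Real.log (2 * Real.pi * Real.exp 1) + Real.log R + Real.log 4) 1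

end PoissonCompression

end

open PoissonCompression

/-!
# Large deviations for the data in the zero cell of a Poisson hyperplane tessellation

Write `g = 2 γ_n · halfMean n`, where `halfMean n` is the mean of `⟪u, v⟫⁺` for a uniform random
unit vector `u` and a fixed unit vector `v`. A point `y` belongs to the zero cell exactly when no
hyperplane separates it from the origin, up to null events, and the hyperplane process charges the
set of hyperplanes that hit the segment from `0` to `y` with mean `g ‖y‖`
(`hyperplaneIntensity_hit_segment`). So `y` is in the zero cell with probability `exp (-g ‖y‖)`.

By Campbell's formula, compatibility with the flow and the independence of the counts of a Poisson
process in disjoint sets, the typical data point does not influence the other data: the event that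
the zero cell contains a data point in `S` other than the origin has the same probability under the
Palm measure and under the original one (`palm_otherDataEvent`, a form of Slivnyak's theorem).
Two moment bounds then carry the proof.

* First moment (`measure_otherDataEvent_le`): the probability of finding data of the zero cell in
  `S` is at most `ℓ ∫_S exp (-g ‖y‖) dy`. In polar coordinates, the integral over a ball of radius
  `r`, or over its complement, is dominated by the sphere of radius `r` as soon as `r` lies below,
  respectively above, the maximizer `(n - 1) / g` of `s ^ (n - 1) exp (-g s)`.
* Second moment (`le_measure_otherDataEvent`): let `V` be the volume of the part of the zero cell
  in a ball. Since `P (y, z ∈ zero cell) ≤ exp (-g (‖y‖ + ‖z‖) / 2)`, rescaling by `2` in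
  each variable gives `E V ^ 2 ≤ 4 ^ n (E V) ^ 2`. Hence the zero cell contains data with
  probability at least `4⁻ⁿ / 2` once its mean number of data points is at least one. This is the
  origin of the term `log 4` in the rates.

Finally, with `r = R n ^ (3 / 2 - α)`, Stirling's formula for the volume of the ball and the
asymptotics of `halfMean n` give the exponential growth rate
`λ + (1 / 2) log (2πe) + log R - √2 ρ R / √π` of `ℓ ∫_S exp (-g ‖y‖) dy`
(`tendsto_log_meanScale`). At the optimal `R = √π / (√2 ρ)` this equals `log (ρ* / ρ)`, which is
positive for `ρ < ρ*`, so that the second moment bound applies to the conditioning event.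
-/

namespace PoissonCompression

/-! ### Counts and restrictions of a Poisson process -/

section Poisson

variable {Ω S : Type*} [MeasurableSpace Ω] [MeasurableSpace S] {P : Measure Ω}
  {N : Ω → Measure S} {Θ : Measure S}

/-- Two probability measures with the same atoms in a countable set that carries the second one
are equal. -/
theorem measure_eq_of_singleton_eq {T : Type*} [MeasurableSpace T] [MeasurableSingletonClass T]
    {μ ν : Measure T} [IsProbabilityMeasure μ] [IsProbabilityMeasure ν] {C : Set T}
    (hC : C.Countable) (hν : ν Cᶜ = 0) (h : ∀ c ∈ C, μ {c} = ν {c}) : μ = ν := by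
  refine (Measure.eq_of_le_of_measure_univ_eq ?_ (by simp)).symm
  refine Measure.le_iff.2 fun s _ => ?_
  have hs : ν s = ν (s ∩ C) := by
    refine le_antisymm ?_ (measure_mono inter_subset_left)
    calc ν s ≤ ν (s ∩ C) + ν (s \ C) := measure_le_inter_add_sdiff _ _ _
      _ ≤ ν (s ∩ C) + 0 := by
        gcongr
        exact (measure_mono fun x hx => hx.2).trans hν.le
      _ = ν (s ∩ C) := add_zero _
  have hsC : (s ∩ C).Countable := hC.mono inter_subset_right
  have key : μ (s ∩ C) = ν (s ∩ C) := by
    rw [← Set.biUnion_of_singleton (s ∩ C), measure_biUnion hsC, measure_biUnion hsC]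
    · exact tsum_congr fun c => h c.1 c.2.2
    all_goals first
      | exact fun x _ y _ hxy => by simpa using hxy
      | exact fun c _ => measurableSet_singleton c
  rw [hs, ← key]
  exact measure_mono inter_subset_left

theorem IsPoissonProcess.measure_eq_natCast (h : IsPoissonProcess P N Θ) {A : Set S}
    (hA : MeasurableSet A) (hΘ : Θ A ≠ ∞) (m : ℕ) :
    P {ω | N ω A = m} =
      ENNReal.ofReal ((Θ A).toReal ^ m / m.factorial * Real.exp (-(Θ A).toReal)) := by
  simpa using h.law 1 (fun _ => A) (fun _ => m) (fun _ => hA)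
    (Subsingleton.pairwise) (fun _ => hΘ)

theorem IsPoissonProcess.measurable_count (h : IsPoissonProcess P N Θ) {A : Set S}
    (hA : MeasurableSet A) : Measurable fun ω => N ω A :=
  (Measure.measurable_coe hA).comp h.measurable

theorem tsum_poisson (r : ℝ) (hr : 0 ≤ r) :
    ∑' m : ℕ, ENNReal.ofReal (r ^ m / m.factorial * Real.exp (-r)) = 1 := by
  lift r to NNReal using hr
  have h := hasSum_one_poissonMeasure r
  rw [← ENNReal.ofReal_one, ← h.tsum_eq, ENNReal.ofReal_tsum_of_nonneg _ h.summable]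
  · exact tsum_congr fun m => by congr 1; ring
  · intro m; positivity

theorem tsum_mul_poisson (r : ℝ) (hr : 0 ≤ r) :
    ∑' m : ℕ, (m : ℝ≥0∞) * ENNReal.ofReal (r ^ m / m.factorial * Real.exp (-r)) =
      ENNReal.ofReal r := by
  rw [tsum_eq_zero_add' ENNReal.summable]
  have : ∀ m : ℕ, ((m + 1 : ℕ) : ℝ≥0∞) *
      ENNReal.ofReal (r ^ (m + 1) / (m + 1).factorial * Real.exp (-r)) =
      ENNReal.ofReal r * ENNReal.ofReal (r ^ m / m.factorial * Real.exp (-r)) := by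
    intro m
    rw [← ENNReal.ofReal_natCast, ← ENNReal.ofReal_mul (by positivity), ← ENNReal.ofReal_mul hr]
    congr 1
    rw [Nat.factorial_succ]
    push_cast
    field_simp
    ring
  simp_rw [this, ENNReal.tsum_mul_left, tsum_poisson r hr]
  simp

/-- The count of a set of finite intensity measure is almost surely finite. -/
theorem IsPoissonProcess.map_count_compl_range (h : IsPoissonProcess P N Θ)
    [IsProbabilityMeasure P] {A : Set S} (hA : MeasurableSet A) (hΘ : Θ A ≠ ∞) :
    P.map (fun ω => N ω A) (range ((↑) : ℕ → ℝ≥0∞))ᶜ = 0 := by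
  have hm := h.measurable_count hA
  have hR : MeasurableSet (range ((↑) : ℕ → ℝ≥0∞)) := (countable_range _).measurableSet
  have := Measure.isProbabilityMeasure_map (μ := P) hm.aemeasurable
  rw [prob_compl_eq_zero_iff hR]
  rw [← biUnion_of_singleton (range ((↑) : ℕ → ℝ≥0∞)), biUnion_range,
    measure_iUnion (fun i j hij => by simpa using hij) (fun i => measurableSet_singleton _)]
  rw [← tsum_poisson (Θ A).toReal ENNReal.toReal_nonneg]
  refine tsum_congr fun m => ?_
  rw [Measure.map_apply hm (measurableSet_singleton _), ← h.measure_eq_natCast hA hΘ]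
  rfl

/-- **Campbell's formula for sets**: the mean number of points in `A` is `Θ A`. -/
theorem IsPoissonProcess.lintegral_count (h : IsPoissonProcess P N Θ)
    [IsProbabilityMeasure P] {A : Set S} (hA : MeasurableSet A) (hΘ : Θ A ≠ ∞) :
    ∫⁻ ω, N ω A ∂P = Θ A := by
  have hm := h.measurable_count hA
  have hR : (range ((↑) : ℕ → ℝ≥0∞)).Countable := countable_range _
  have h1 : ∫⁻ ω, N ω A ∂P = ∫⁻ x, x ∂(P.map fun ω => N ω A) :=
    (lintegral_map measurable_id hm).symm
  have h2 : (P.map fun ω => N ω A) = (P.map fun ω => N ω A).restrict (range ((↑) : ℕ → ℝ≥0∞)) :=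
    (Measure.restrict_eq_self_of_ae_mem
      (mem_ae_iff.2 (h.map_count_compl_range hA hΘ))).symm
  rw [h1, h2, lintegral_countable _ hR]
  have e := (Equiv.ofInjective ((↑) : ℕ → ℝ≥0∞) Nat.cast_injective).tsum_eq
    (fun a : range ((↑) : ℕ → ℝ≥0∞) => (a : ℝ≥0∞) * (P.map fun ω => N ω A) {(a : ℝ≥0∞)})
  rw [← e, ← ENNReal.ofReal_toReal hΘ, ← tsum_mul_poisson _ ENNReal.toReal_nonneg]
  refine tsum_congr fun m => ?_
  rw [← h.measure_eq_natCast hA hΘ, Measure.map_apply hm (measurableSet_singleton _)]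
  rfl

/-- The counts of disjoint sets are independent random variables. -/
theorem IsPoissonProcess.iIndepFun_count (h : IsPoissonProcess P N Θ)
    [IsProbabilityMeasure P] {ι : Type*} [Fintype ι] {A : ι → Set S}
    (hA : ∀ i, MeasurableSet (A i)) (hd : Pairwise (Function.onFun Disjoint A))
    (hΘ : ∀ i, Θ (A i) ≠ ∞) : iIndepFun (fun i ω => N ω (A i)) P := by
  classical
  let e := (Fintype.equivFin ι).symm
  refine (iIndepFun_precomp_of_bijective e.bijective).1 ?_
  have hm : ∀ i, Measurable fun ω => N ω (A i) := fun i => h.measurable_count (hA i)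
  rw [iIndepFun_iff_map_fun_eq_pi_map (fun i => (hm _).aemeasurable)]
  have : ∀ i, IsProbabilityMeasure (P.map fun ω => N ω (A (e i))) := fun i =>
    Measure.isProbabilityMeasure_map (hm _).aemeasurable
  have hpi : Measurable fun ω i => N ω (A (e i)) := measurable_pi_lambda _ fun i => hm _
  have := Measure.isProbabilityMeasure_map (μ := P) hpi.aemeasurable
  refine measure_eq_of_singleton_eq
    (C := univ.pi fun _ => range ((↑) : ℕ → ℝ≥0∞)) ?_ ?_ ?_
  · exact Set.countable_univ_pi fun _ => countable_range _
  · rw [prob_compl_eq_zero_iff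
      (MeasurableSet.univ_pi fun _ => (countable_range _).measurableSet), Measure.pi_pi]
    refine Finset.prod_eq_one fun i _ => ?_
    rw [← prob_compl_eq_zero_iff (countable_range _).measurableSet]
    exact h.map_count_compl_range (hA _) (hΘ _)
  · intro c hc
    choose m hmc using fun i => hc i (mem_univ i)
    rw [Measure.pi_singleton, Measure.map_apply hpi (measurableSet_singleton _)]
    have h1 := h.law _ (fun i => A (e i)) m (fun i => hA _)
      (hd.comp_of_injective e.injective) (fun i => hΘ _)
    have h2 : (fun ω i => N ω (A (e i))) ⁻¹' {c} = {ω | ∀ i, N ω (A (e i)) = m i} := by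
      ext ω
      simp only [mem_preimage, mem_singleton_iff, funext_iff, mem_ofPred_eq]
      exact forall_congr' fun i => by rw [← hmc i]
    rw [h2, h1]
    refine Finset.prod_congr rfl fun i _ => ?_
    rw [← h.measure_eq_natCast (hA _) (hΘ _), Measure.map_apply (hm _) (measurableSet_singleton _),
      ← hmc i]
    rfl

/-- **Complete independence**: the count of a set `A` is independent of the restriction, as a
random measure, of the process to a set disjoint from `A`. -/
theorem IsPoissonProcess.indepFun_restrict (h : IsPoissonProcess P N Θ)
    [IsProbabilityMeasure P] {A W : Set S} (hA : MeasurableSet A) (hW : MeasurableSet W)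
    (hΘA : Θ A ≠ ∞) (hΘW : Θ W ≠ ∞) (hAW : Disjoint A W) :
    IndepFun (fun ω => N ω A) (fun ω => (N ω).restrict W) P := by
  classical
  have hm : ∀ {B : Set S}, MeasurableSet B → Measurable fun ω => N ω B :=
    fun hB => h.measurable_count hB
  have hproc : IndepFun (fun ω => N ω A)
      (fun ω (B : {B : Set S // MeasurableSet B}) => N ω (B.1 ∩ W)) P := by
    refine IndepFun.indepFun_process (Y := fun (B : {B : Set S // MeasurableSet B}) ω =>
      N ω (B.1 ∩ W)) (hm hA) (fun B => hm (B.2.inter hW)) fun I => ?_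
    -- The sets `B ∩ W`, `B ∈ I`, are disjoint unions of atoms, which are indexed by `some s`.
    let atom : Option (I → Prop) → Set S := fun o => o.elim A fun s =>
      {x | x ∈ W ∧ ∀ i : I, x ∈ i.1.1 ↔ s i}
    have hatom : ∀ o, MeasurableSet (atom o) := by
      rintro (_ | s)
      · exact hA
      · refine hW.inter (MeasurableSet.iInter fun i : I => ?_ :
          MeasurableSet (⋂ i : I, {x | x ∈ i.1.1 ↔ s i})) |>.congr ?_
        · by_cases hs : s i
          · exact i.1.2.congr (by ext x; simp [hs])
          · exact i.1.2.compl.congr (by ext x; simp [hs])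
        · ext x; simp [atom]
    have hdisj : Pairwise (Function.onFun Disjoint atom) := by
      rintro (_ | s) (_ | t) hst
      · exact absurd rfl hst
      · exact hAW.mono_right fun x hx => hx.1
      · exact (hAW.mono_right fun x hx => hx.1).symm
      · refine Set.disjoint_left.2 fun x hx hy => hst ?_
        congr 1
        ext i
        exact (hx.2 i).symm.trans (hy.2 i)
    have hfin : ∀ o, Θ (atom o) ≠ ∞ := by
      rintro (_ | s)
      · exact hΘA
      · exact measure_ne_top_of_subset (fun x hx => hx.1) hΘW
    have hind := (h.iIndepFun_count hatom hdisj hfin).indepFun_finset {none}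
      (Finset.univ.erase none) (by simp) (fun o => hm (hatom o))
    have hsum : ∀ (i : I) ω, N ω (i.1.1 ∩ W) =
        ∑ s : I → Prop, if s i then N ω (atom (some s)) else 0 := by
      intro i ω
      rw [← Finset.sum_filter, ← measure_biUnion_finset (f := fun s => atom (some s))
        (fun s _ t _ hst => hdisj (by simpa using hst)) (fun s _ => hatom _)]
      congr 1
      ext x
      simp only [mem_inter_iff, Finset.mem_filter, Finset.mem_univ, true_and, mem_iUnion,
        exists_prop]
      constructor
      · rintro ⟨hx, hxW⟩
        exact ⟨fun j => x ∈ j.1.1, hx, hxW, fun _ => Iff.rfl⟩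
      · rintro ⟨s, hs, hxW, hx⟩
        exact ⟨(hx i).2 hs, hxW⟩
    have hφ : Measurable fun v : ↥({none} : Finset (Option (I → Prop))) → ℝ≥0∞ =>
        v ⟨none, by simp⟩ := measurable_pi_apply _
    have hψ : Measurable fun (v : ↥((Finset.univ : Finset (Option (I → Prop))).erase none) → ℝ≥0∞)
        (i : I) => ∑ s : I → Prop, if s i then v ⟨some s, by simp⟩ else 0 := by
      refine measurable_pi_lambda _ fun i => Finset.measurable_sum _ fun s _ => ?_
      split_ifs
      · exact measurable_pi_apply _
      · exact measurable_const
    have := hind.comp hφ hψ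
    have hY : (fun ω (B : I) => N ω (B.1.1 ∩ W)) =
        (fun v (i : I) => ∑ s : I → Prop, if s i then v ⟨some s, by simp⟩ else 0) ∘
          fun ω (o : ↥((Finset.univ : Finset (Option (I → Prop))).erase none)) =>
            N ω (atom o) := by
      funext ω i
      exact hsum i ω
    rw [hY]
    exact this
  rw [IndepFun_iff_Indep] at hproc ⊢
  refine indep_of_indep_of_le_right hproc ?_
  rw [MeasurableSpace.comap_le_iff_le_map, Measure.instMeasurableSpace]
  refine iSup₂_le fun B hB => ?_
  rintro _ ⟨s, hs, rfl⟩
  refine ⟨(fun v : {B : Set S // MeasurableSet B} → ℝ≥0∞ => v ⟨B, hB⟩) ⁻¹' s,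
    measurable_pi_apply _ hs, ?_⟩
  ext ω
  simp [Measure.restrict_apply hB]

end Poisson

/-- If `(f, g)` is independent of `X` and `f` of `g`, then `f` is independent of `(g, X)`. -/
theorem indepFun_prodMk_of_indepFun {Ω α β δ : Type*} [MeasurableSpace Ω] [MeasurableSpace α]
    [MeasurableSpace β] [MeasurableSpace δ] {P : Measure Ω} [IsProbabilityMeasure P]
    {f : Ω → α} {g : Ω → β} {X : Ω → δ} (hf : Measurable f) (hg : Measurable g)
    (hX : Measurable X) (h : IndepFun (fun ω => (f ω, g ω)) X P) (hfg : IndepFun f g P) :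
    IndepFun f (fun ω => (g ω, X ω)) P := by
  have hgX : IndepFun g X P := h.comp measurable_snd measurable_id
  rw [indepFun_iff_map_prod_eq_prod_map_map hf.aemeasurable (hg.prodMk hX).aemeasurable]
  rw [indepFun_iff_map_prod_eq_prod_map_map (hf.prodMk hg).aemeasurable hX.aemeasurable] at h
  rw [indepFun_iff_map_prod_eq_prod_map_map hf.aemeasurable hg.aemeasurable] at hfg
  rw [indepFun_iff_map_prod_eq_prod_map_map hg.aemeasurable hX.aemeasurable] at hgX
  have := Measure.isProbabilityMeasure_map (μ := P) hf.aemeasurable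
  have := Measure.isProbabilityMeasure_map (μ := P) hg.aemeasurable
  have := Measure.isProbabilityMeasure_map (μ := P) hX.aemeasurable
  rw [hgX, ← Measure.prodAssoc_prod, ← hfg, ← h,
    Measure.map_map (MeasurableEquiv.measurable _) ((hf.prodMk hg).prodMk hX)]
  rfl

/-! ### Counting measures -/

section Counting

variable {S : Type*} [MeasurableSpace S]

theorem IsCountingMeasure.eq_zero_iff {μ : Measure S} (h : IsCountingMeasure μ) {A : Set S}
    [MeasurableSingletonClass S] (hA : MeasurableSet A) : μ A = 0 ↔ ∀ x ∈ points μ, x ∉ A := by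
  constructor
  · intro h0 x hx hxA
    exact hx (measure_mono_null (singleton_subset_iff.2 hxA) h0)
  · obtain ⟨ι, _, s, rfl⟩ := h
    intro hx
    rw [Measure.sum_apply _ hA, ENNReal.tsum_eq_zero]
    intro i
    rw [Measure.dirac_apply' _ hA, indicator_of_notMem]
    refine hx _ ?_
    rw [points, mem_ofPred_eq, Measure.sum_apply _ (measurableSet_singleton _)]
    intro h0
    have := ENNReal.tsum_eq_zero.1 h0 i
    simp at this

/-- A set of finite measure contains finitely many atoms of a counting measure. -/
theorem IsCountingMeasure.finite_points {μ : Measure S} (h : IsCountingMeasure μ) {A : Set S}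
    [MeasurableSingletonClass S] (hA : MeasurableSet A) (hfin : μ A ≠ ∞) :
    (points μ ∩ A).Finite := by
  obtain ⟨ι, _, s, rfl⟩ := h
  have h1 : {i | s i ∈ A}.Finite := by
    rw [Measure.sum_apply _ hA] at hfin
    have : ∀ i, Measure.dirac (s i) A = {i | s i ∈ A}.indicator (fun _ => (1 : ℝ≥0∞)) i := by
      intro i
      rw [Measure.dirac_apply' _ hA]
      rfl
    simp_rw [this] at hfin
    rw [← tsum_subtype, ENNReal.tsum_const] at hfin
    by_contra hinf
    have := Set.Infinite.to_subtype hinf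
    simp at hfin
  refine (h1.image s).subset ?_
  rintro x ⟨hx, hxA⟩
  rw [points, mem_ofPred_eq, Measure.sum_apply _ (measurableSet_singleton _)] at hx
  by_contra hne
  refine hx (ENNReal.tsum_eq_zero.2 fun i => ?_)
  rw [Measure.dirac_apply' _ (measurableSet_singleton _), indicator_of_notMem]
  rintro rfl
  exact hne ⟨i, hxA, rfl⟩

end Counting

/-! ### The zero cell as a set of void segments -/

variable {n : ℕ}

theorem Hyperplane.measurableSet_hit {C : Set (E n)} (hC : IsCompact C) :
    MeasurableSet (Hyperplane.hit C) :=
  MeasurableSpace.measurableSet_generateFrom ⟨C, hC, rfl⟩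

theorem Hyperplane.isClosed (H : Hyperplane n) : IsClosed H.1 := by
  obtain ⟨H, u, τ, rfl⟩ := H
  exact isClosed_eq (by fun_prop) continuous_const

/-- A hyperplane that is contained in another one is equal to it. -/
theorem Hyperplane.eq_of_subset {H K : Hyperplane n} (h : H.1 ⊆ K.1) : H = K := by
  obtain ⟨H, u, τ, rfl⟩ := H
  obtain ⟨K, v, σ, rfl⟩ := K
  have hu : ⟪(u : E n), (u : E n)⟫ = 1 := by
    rw [real_inner_self_eq_norm_sq, mem_sphere_zero_iff_norm.1 u.2, one_pow]
  have hv : ⟪(v : E n), (v : E n)⟫ = 1 := by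
    rw [real_inner_self_eq_norm_sq, mem_sphere_zero_iff_norm.1 v.2, one_pow]
  -- The component of `v` orthogonal to `u` is a direction of the first hyperplane.
  set c := ⟪(v : E n), (u : E n)⟫ with hc
  have h1 : ⟪τ • (u : E n), (v : E n)⟫ = σ := h (by simp [inner_smul_left])
  have h2 : ⟪τ • (u : E n) + ((v : E n) - c • (u : E n)), (v : E n)⟫ = σ := h (by
    simp only [mem_ofPred_eq, inner_add_left, inner_sub_left, real_inner_smul_left, hu, ← hc]
    ring)
  have hcc : c * c = 1 := by
    simp only [inner_add_left, inner_sub_left, real_inner_smul_left, hv,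
      real_inner_comm (v : E n) (u : E n), ← hc] at h1 h2
    linarith
  have hvu : (v : E n) = c • (u : E n) := by
    rw [← sub_eq_zero, ← norm_eq_zero, ← sq_eq_zero_iff, ← real_inner_self_eq_norm_sq]
    simp only [inner_sub_left, inner_sub_right, real_inner_smul_left, real_inner_smul_right, hu, hv,
      real_inner_comm (v : E n) (u : E n), ← hc]
    linarith
  apply Subtype.ext
  ext x
  simp only [mem_ofPred_eq]
  rw [hvu, real_inner_smul_right]
  rw [hvu, real_inner_smul_right, real_inner_smul_left, hu] at h1
  rw [← h1]
  have hc0 : c ≠ 0 := by rintro h0; rw [h0] at hcc; simp at hcc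
  constructor
  · intro hx; rw [hx]; ring
  · intro hx
    have := mul_left_cancel₀ hc0 hx
    linarith

instance Hyperplane.instMeasurableSingletonClass : MeasurableSingletonClass (Hyperplane n) := by
  refine ⟨fun H => ?_⟩
  -- `H` is the only hyperplane that misses all the closed balls of a countable family that
  -- exhausts the complement of `H`.
  have : ({H} : Set (Hyperplane n)) = ⋂ (k : ℕ) (m : ℕ)
      (_ : H ∉ hit (Metric.closedBall (TopologicalSpace.denseSeq (E n) k) (1 / (m + 1 : ℝ)))),
      (hit (Metric.closedBall (TopologicalSpace.denseSeq (E n) k) (1 / (m + 1 : ℝ))))ᶜ := by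
    ext K
    simp only [mem_singleton_iff, mem_iInter, mem_compl_iff]
    constructor
    · rintro rfl k m h
      exact h
    · intro hK
      refine eq_of_subset fun x hx => ?_
      by_contra hxH
      obtain ⟨ε, hε, hball⟩ := Metric.isOpen_iff.1 H.isClosed.isOpen_compl x hxH
      obtain ⟨m, hm⟩ := exists_nat_one_div_lt (half_pos hε)
      obtain ⟨k, hk⟩ := (TopologicalSpace.denseRange_denseSeq (E n)).exists_dist_lt x
        (Nat.one_div_pos_of_nat (n := m) (α := ℝ))
      refine hK k m ?_ ⟨x, hx, Metric.mem_closedBall.2 hk.le⟩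
      rintro ⟨y, hyH, hy⟩
      refine hball (Metric.mem_ball.2 ?_) hyH
      calc dist y x ≤ dist y (TopologicalSpace.denseSeq (E n) k)
            + dist (TopologicalSpace.denseSeq (E n) k) x := dist_triangle _ _ _
        _ ≤ 1 / (m + 1 : ℝ) + 1 / (m + 1 : ℝ) := by
          rw [dist_comm _ x]; exact add_le_add (Metric.mem_closedBall.1 hy) hk.le
        _ < ε := by linarith
  rw [this]
  exact MeasurableSet.iInter fun k => MeasurableSet.iInter fun m => MeasurableSet.iInter fun _ =>
    (measurableSet_hit (isCompact_closedBall _ _)).compl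

theorem isCompact_segment (a b : E n) : IsCompact (segment ℝ a b) := by
  rw [segment_eq_image]
  exact isCompact_Icc.image (by fun_prop)

/-- The factors `1 - 1 / (k + 1)`, which increase to one. -/
noncomputable def shrink (k : ℕ) : ℝ := 1 - 1 / (k + 1)

theorem shrink_nonneg (k : ℕ) : 0 ≤ shrink k := by
  have : (1 : ℝ) / (k + 1) ≤ 1 := by
    rw [div_le_one (by positivity)]; linarith [Nat.cast_nonneg (α := ℝ) k]
  simp only [shrink]; linarith

theorem shrink_lt_one (k : ℕ) : shrink k < 1 := by
  have : (0 : ℝ) < 1 / (k + 1) := by positivity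
  simp only [shrink]; linarith

theorem tendsto_shrink : Tendsto shrink atTop (𝓝 1) := by
  have := (tendsto_one_div_add_atTop_nhds_zero_nat (𝕜 := ℝ)).const_sub 1
  rw [sub_zero] at this
  exact this

theorem mem_segment_zero_smul {y z : E n} {t : ℝ} :
    z ∈ segment ℝ 0 (t • y) ↔ ∃ s ∈ Icc (0 : ℝ) 1, z = (s * t) • y := by
  rw [segment_eq_image]
  simp only [smul_zero, zero_add, mem_image, smul_smul]
  exact ⟨fun ⟨s, hs, h⟩ => ⟨s, hs, h.symm⟩, fun ⟨s, hs, h⟩ => ⟨s, hs, h.symm⟩⟩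

/-- The component of the origin in the complement of a union of hyperplanes consists of the points
that are joined to the origin by a segment in this complement. -/
theorem mem_connectedComponentIn_iff {F : Set (Hyperplane n)} {y : E n} :
    y ∈ connectedComponentIn (⋃ H ∈ F, H.1)ᶜ 0 ↔ segment ℝ 0 y ⊆ (⋃ H ∈ F, H.1)ᶜ := by
  set O := (⋃ H ∈ F, (H : Hyperplane n).1)ᶜ with hO
  constructor
  · intro hy
    have h0 : (0 : E n) ∈ O := by
      by_contra h0
      rw [connectedComponentIn_eq_empty h0] at hy
      exact hy
    have hyO : y ∈ O := connectedComponentIn_subset _ _ hy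
    intro z hz hzF
    simp only [mem_iUnion, exists_prop] at hzF
    obtain ⟨H, hHF, hzH⟩ := hzF
    have hmiss : ∀ x ∈ O, x ∉ H.1 := fun x hx hxH =>
      hx (mem_iUnion₂.2 ⟨H, hHF, hxH⟩)
    obtain ⟨H, u, τ, rfl⟩ := H
    simp only [mem_ofPred_eq] at hmiss hzH
    -- The affine function defining `H` would change sign on the connected component.
    have hconv : IsPreconnected (connectedComponentIn O 0) := isPreconnected_connectedComponentIn
    have himg := (hconv.image (fun x => ⟪x, (u : E n)⟫) (by fun_prop)).ordConnected
    have h0' : (0 : ℝ) ∈ (fun x => ⟪x, (u : E n)⟫) '' connectedComponentIn O 0 :=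
      ⟨0, mem_connectedComponentIn h0, by simp⟩
    have hy' : ⟪y, (u : E n)⟫ ∈ (fun x => ⟪x, (u : E n)⟫) '' connectedComponentIn O 0 :=
      ⟨y, hy, rfl⟩
    have hτ : τ ∈ uIcc 0 ⟪y, (u : E n)⟫ := by
      have hz1 : z ∈ segment ℝ 0 ((1 : ℝ) • y) := by simpa using hz
      obtain ⟨s, hs, rfl⟩ := mem_segment_zero_smul.1 hz1
      rw [← hzH, real_inner_smul_left, mul_one, ← segment_eq_uIcc, segment_eq_image]
      exact ⟨s, hs, by simp⟩
    obtain ⟨x, hx, hxτ⟩ := himg.uIcc_subset h0' hy' hτ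
    exact hmiss x (connectedComponentIn_subset _ _ hx) hxτ
  · intro h
    exact (convex_segment (0 : E n) y).isPreconnected.subset_connectedComponentIn
      (left_mem_segment ℝ 0 y) h (right_mem_segment ℝ 0 y)

theorem mem_closure_component_iff {F : Set (Hyperplane n)} {y : E n} :
    y ∈ closure (connectedComponentIn (⋃ H ∈ F, H.1)ᶜ 0) ↔
      ∀ k : ℕ, segment ℝ 0 (shrink k • y) ⊆ (⋃ H ∈ F, H.1)ᶜ := by
  constructor
  · intro hy k z hz hzF
    simp only [mem_iUnion, exists_prop] at hzF
    obtain ⟨H, hHF, hzH⟩ := hzF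
    obtain ⟨s, hs, rfl⟩ := mem_segment_zero_smul.1 hz
    have hU : ∀ x ∈ connectedComponentIn (⋃ H ∈ F, H.1)ᶜ 0, ∀ w ∈ segment ℝ 0 x, w ∉ H.1 := by
      intro x hx w hw hwH
      exact mem_connectedComponentIn_iff.1 hx hw (mem_iUnion₂.2 ⟨H, hHF, hwH⟩)
    obtain ⟨H, u, τ, rfl⟩ := H
    simp only [mem_ofPred_eq] at hU hzH
    have hne : (connectedComponentIn (⋃ H ∈ F, H.1)ᶜ 0).Nonempty := by
      rw [← closure_nonempty_iff]; exact ⟨y, hy⟩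
    obtain ⟨x₀, hx₀⟩ := hne
    have hτ0 : τ ≠ 0 := by
      have := hU x₀ hx₀ 0 (left_mem_segment ℝ 0 x₀)
      simpa [eq_comm] using this
    -- On the component, the function `⟪·, u⟫ / τ` stays below one.
    have hlt : ∀ x ∈ connectedComponentIn (⋃ H ∈ F, H.1)ᶜ 0, ⟪x, (u : E n)⟫ / τ ≤ 1 := by
      intro x hx
      by_contra! hgt
      have hpos : 0 < ⟪x, (u : E n)⟫ / τ := by linarith
      refine hU x hx ((⟪x, (u : E n)⟫ / τ)⁻¹ • x) ?_ ?_
      · have h1 := @mem_segment_zero_smul n x ((⟪x, (u : E n)⟫ / τ)⁻¹ • x) 1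
        rw [one_smul] at h1
        exact h1.2 ⟨(⟪x, (u : E n)⟫ / τ)⁻¹,
          ⟨by positivity, inv_le_one_of_one_le₀ hgt.le⟩, by rw [mul_one]⟩
      · rw [real_inner_smul_left]
        have : ⟪x, (u : E n)⟫ ≠ 0 := by
          rintro h0; rw [h0] at hpos; simp at hpos
        field_simp
    have hcl : ⟪y, (u : E n)⟫ / τ ≤ 1 := by
      have hclosed : IsClosed {x : E n | ⟪x, (u : E n)⟫ / τ ≤ 1} :=
        isClosed_le (by fun_prop) continuous_const
      exact closure_minimal hlt hclosed hy
    rw [real_inner_smul_left] at hzH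
    have h1 : s * shrink k * (⟪y, (u : E n)⟫ / τ) = 1 := by
      rw [← mul_div_assoc, hzH, div_self hτ0]
    have h2 : s * shrink k < 1 :=
      lt_of_le_of_lt (mul_le_of_le_one_left (shrink_nonneg k) hs.2) (shrink_lt_one k)
    have h3 : 0 ≤ s * shrink k := mul_nonneg hs.1 (shrink_nonneg k)
    nlinarith
  · intro h
    have hlim : Tendsto (fun k => shrink k • y) atTop (𝓝 y) := by
      simpa using tendsto_shrink.smul_const y
    exact mem_closure_of_tendsto hlim
      (Eventually.of_forall fun k => mem_connectedComponentIn_iff.2 (h k))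

/-- A point `y` belongs to the zero cell if and only if no hyperplane meets the segments from the
origin to the points `t • y` with `t < 1`. -/
theorem mem_zeroCell_iff {μ : Measure (Hyperplane n)} (hμ : IsCountingMeasure μ) {y : E n} :
    y ∈ zeroCell μ ↔ ∀ k : ℕ, μ (Hyperplane.hit (segment ℝ 0 (shrink k • y))) = 0 := by
  rw [zeroCell, mem_closure_component_iff]
  refine forall_congr' fun k => ?_
  rw [hμ.eq_zero_iff (Hyperplane.measurableSet_hit (isCompact_segment _ _))]
  constructor
  · rintro h H hH ⟨x, hxH, hx⟩
    exact h hx (mem_iUnion₂.2 ⟨H, hH, hxH⟩)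
  · intro h x hx hxF
    obtain ⟨H, hH, hxH⟩ := mem_iUnion₂.1 hxF
    exact h H hH ⟨x, hxH, hx⟩

/-! ### Joint measurability of the cells -/

/-- The triples `(a, b, μ)` for which the hyperplanes of `μ` miss a neighbourhood of the segment
from `a` to `b`, written as a countable union of measurable rectangles. -/
def voidSegment (n : ℕ) : Set ((E n × E n) × Measure (Hyperplane n)) :=
  ⋃ (m : ℕ) (i : ℕ) (j : ℕ),
    (Metric.ball (TopologicalSpace.denseSeq (E n) i) (1 / (m + 1 : ℝ)) ×ˢ
      Metric.ball (TopologicalSpace.denseSeq (E n) j) (1 / (m + 1 : ℝ))) ×ˢ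
    {μ | μ (Hyperplane.hit (Metric.cthickening (1 / (m + 1 : ℝ))
      (segment ℝ (TopologicalSpace.denseSeq (E n) i) (TopologicalSpace.denseSeq (E n) j)))) = 0}

theorem isCompact_cthickening_segment (a b : E n) (δ : ℝ) :
    IsCompact (Metric.cthickening δ (segment ℝ a b)) :=
  (isCompact_segment a b).cthickening

theorem measurableSet_voidSegment : MeasurableSet (voidSegment n) := by
  refine MeasurableSet.iUnion fun m => MeasurableSet.iUnion fun i =>
    MeasurableSet.iUnion fun j => ?_
  refine (measurableSet_ball.prod measurableSet_ball).prod ?_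
  exact (Measure.measurable_coe (Hyperplane.measurableSet_hit
    (isCompact_cthickening_segment _ _ _))) (measurableSet_singleton 0)

theorem Hyperplane.hit_mono {C D : Set (E n)} (h : C ⊆ D) : hit C ⊆ hit D :=
  fun _ hH => hH.mono (inter_subset_inter_right _ h)

theorem segment_subset_cthickening {a b a' b' : E n} {δ : ℝ} (ha : dist a a' ≤ δ)
    (hb : dist b b' ≤ δ) : segment ℝ a b ⊆ Metric.cthickening δ (segment ℝ a' b') := by
  rintro _ ⟨s, t, hs, ht, hst, rfl⟩
  refine Metric.mem_cthickening_of_dist_le _ (s • a' + t • b') _ _ ⟨s, t, hs, ht, hst, rfl⟩ ?_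
  calc dist (s • a + t • b) (s • a' + t • b')
      ≤ dist (s • a) (s • a') + dist (t • b) (t • b') := dist_add_add_le _ _ _ _
    _ = s * dist a a' + t * dist b b' := by
      rw [dist_smul₀, dist_smul₀, Real.norm_of_nonneg hs, Real.norm_of_nonneg ht]
    _ ≤ s * δ + t * δ := by gcongr
    _ = δ := by rw [← add_mul, hst, one_mul]

theorem mem_voidSegment_iff {μ : Measure (Hyperplane n)} (hμ : IsCountingMeasure μ)
    (hfin : ∀ C : Set (E n), IsCompact C → μ (Hyperplane.hit C) ≠ ∞) {a b : E n} :
    ((a, b), μ) ∈ voidSegment n ↔ μ (Hyperplane.hit (segment ℝ a b)) = 0 := by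
  simp only [voidSegment, mem_iUnion, mem_prod, Metric.mem_ball, mem_ofPred_eq]
  constructor
  · rintro ⟨m, i, j, ⟨ha, hb⟩, h⟩
    exact measure_mono_null (Hyperplane.hit_mono (segment_subset_cthickening ha.le hb.le)) h
  · intro h
    have hK := isCompact_segment a b
    -- Only finitely many hyperplanes come near the segment; they have a positive distance to it.
    have hF := hμ.finite_points (Hyperplane.measurableSet_hit
      (isCompact_cthickening_segment a b 1)) (hfin _ (isCompact_cthickening_segment a b 1))
    set F := points μ ∩ Hyperplane.hit (Metric.cthickening 1 (segment ℝ a b)) with hFdef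
    have hclosed : IsClosed (⋃ H ∈ F, (H : Hyperplane n).1) :=
      hF.isClosed_biUnion fun H _ => H.isClosed
    have hdisj : Disjoint (segment ℝ a b) (⋃ H ∈ F, (H : Hyperplane n).1) := by
      refine Set.disjoint_left.2 fun x hx hxF => ?_
      obtain ⟨H, hH, hxH⟩ := mem_iUnion₂.1 hxF
      exact (hμ.eq_zero_iff (Hyperplane.measurableSet_hit hK)).1 h H hH.1 ⟨x, hxH, hx⟩
    obtain ⟨δ, hδ, hδd⟩ := hdisj.exists_cthickenings hK hclosed
    obtain ⟨m, hm⟩ := exists_nat_one_div_lt (half_pos (lt_min hδ one_pos))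
    have hpos : (0 : ℝ) < 1 / (m + 1 : ℝ) := by positivity
    obtain ⟨i, hi⟩ := (TopologicalSpace.denseRange_denseSeq (E n)).exists_dist_lt a hpos
    obtain ⟨j, hj⟩ := (TopologicalSpace.denseRange_denseSeq (E n)).exists_dist_lt b hpos
    refine ⟨m, i, j, ⟨hi, hj⟩, ?_⟩
    rw [hμ.eq_zero_iff (Hyperplane.measurableSet_hit (isCompact_cthickening_segment _ _ _))]
    rintro H hH ⟨x, hxH, hx⟩
    have hx2 : x ∈ Metric.cthickening (1 / (m + 1 : ℝ) + 1 / (m + 1 : ℝ)) (segment ℝ a b) := by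
      refine Metric.cthickening_cthickening_subset hpos.le hpos.le _
        (Metric.cthickening_subset_of_subset _ (segment_subset_cthickening ?_ ?_) hx)
      · rw [dist_comm]; exact hi.le
      · rw [dist_comm]; exact hj.le
    have hle1 : 1 / (m + 1 : ℝ) + 1 / (m + 1 : ℝ) ≤ 1 := by
      linarith [min_le_right δ 1]
    have hleδ : 1 / (m + 1 : ℝ) + 1 / (m + 1 : ℝ) ≤ δ := by
      linarith [min_le_left δ 1]
    refine Set.disjoint_left.1 hδd (Metric.cthickening_mono hleδ _ hx2)
      (Metric.self_subset_cthickening _ (mem_iUnion₂.2 ⟨H, ⟨hH, ?_⟩, hxH⟩))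
    exact ⟨x, hxH, Metric.cthickening_mono hle1 _ hx2⟩

/-- The triples `(x, y, μ)` such that `y` belongs to the cell of `x` and `y - x ∈ S`. -/
def cellGraph (S : Set (E n)) : Set ((E n × Measure (Hyperplane n)) × E n) :=
  {p | p.2 - p.1.1 ∈ S ∧
    ∀ k : ℕ, ((p.1.1, p.1.1 + shrink k • (p.2 - p.1.1)), p.1.2) ∈ voidSegment n}

theorem measurableSet_cellGraph {S : Set (E n)} (hS : MeasurableSet S) :
    MeasurableSet (cellGraph S) := by
  have h1 : Measurable fun p : (E n × Measure (Hyperplane n)) × E n => p.2 - p.1.1 := by fun_prop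
  have h2 : MeasurableSet (⋂ k : ℕ, {p : (E n × Measure (Hyperplane n)) × E n |
      ((p.1.1, p.1.1 + shrink k • (p.2 - p.1.1)), p.1.2) ∈ voidSegment n}) :=
    MeasurableSet.iInter fun k => measurableSet_voidSegment.preimage (by fun_prop)
  refine ((h1 hS).inter h2).congr ?_
  ext p
  simp [cellGraph]

theorem Hyperplane.shift_preimage_hit (x : E n) (C : Set (E n)) :
    shift x ⁻¹' hit C = hit ((fun y => y + x) '' C) := by
  ext H
  simp only [shift, hit, mem_preimage, mem_ofPred_eq]
  constructor
  · rintro ⟨y, hy, hyC⟩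
    exact ⟨y + x, hy, y, hyC, rfl⟩
  · rintro ⟨_, hz, y, hyC, rfl⟩
    exact ⟨y, hz, hyC⟩

theorem mem_cellGraph_iff {μ : Measure (Hyperplane n)} (hμ : IsCountingMeasure μ)
    (hfin : ∀ C : Set (E n), IsCompact C → μ (Hyperplane.hit C) ≠ ∞) {S : Set (E n)} {x y : E n}
    (hμx : IsCountingMeasure (μ.map (Hyperplane.shift x))) :
    ((x, μ), y) ∈ cellGraph S ↔ y - x ∈ zeroCell (μ.map (Hyperplane.shift x)) ∩ S := by
  rw [mem_inter_iff, and_comm, mem_zeroCell_iff hμx, cellGraph, mem_ofPred_eq]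
  refine and_congr_right fun _ => forall_congr' fun k => ?_
  rw [mem_voidSegment_iff hμ hfin, Measure.map_apply (Hyperplane.measurable_shift x)
    (Hyperplane.measurableSet_hit (isCompact_segment _ _)), Hyperplane.shift_preimage_hit]
  have : (fun y => y + x) '' segment ℝ 0 (shrink k • (y - x)) =
      segment ℝ x (x + shrink k • (y - x)) := by
    simp_rw [add_comm _ x]
    rw [segment_translate_image, add_zero]
  rw [this]

/-! ### Campbell measures -/

section Campbell

variable {Ω S T : Type*} [MeasurableSpace Ω] [MeasurableSpace S] [MeasurableSpace T]
  {P : Measure Ω} {N : Ω → Measure S} {Θ : Measure S}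

theorem measurable_restrict_measure {B : Set S} (hB : MeasurableSet B) :
    Measurable fun μ : Measure S => μ.restrict B := by
  refine Measure.measurable_of_measurable_coe _ fun s hs => ?_
  simp_rw [Measure.restrict_apply hs]
  exact Measure.measurable_coe (hs.inter hB)

/-- The Campbell measure of a point process `N` restricted to the window `B`: the mean number of
pairs `(x, ω)` in a set, where `x` runs through the points of `N ω` in `B`. -/
noncomputable def campbell (P : Measure Ω) (N : Ω → Measure S) (B : Set S) : Measure (S × Ω) :=
  P.bind fun ω => ((N ω).restrict B).map fun x => (x, ω)

theorem measurable_restrict_apply (hN : Measurable N) {B : Set S} (hB : MeasurableSet B)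
    (hfin : ∀ ω, N ω B ≠ ∞) {A : Set (S × Ω)} (hA : MeasurableSet A) :
    Measurable fun ω => (N ω).restrict B {x | (x, ω) ∈ A} := by
  let κ : Kernel Ω S := Kernel.restrict ⟨N, hN⟩ hB
  exact Kernel.measurable_kernel_prodMk_left_of_finite (κ := κ)
    (t := {p : Ω × S | (p.2, p.1) ∈ A}) (hA.preimage measurable_swap)
    (fun ω => ⟨by simpa [κ, Kernel.restrict_apply] using (hfin ω).lt_top⟩)

theorem campbell_apply (hN : Measurable N) {B : Set S} (hB : MeasurableSet B)
    (hfin : ∀ ω, N ω B ≠ ∞) {A : Set (S × Ω)} (hA : MeasurableSet A) :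
    campbell P N B A = ∫⁻ ω, (N ω).restrict B {x | (x, ω) ∈ A} ∂P := by
  have key : ∀ {A : Set (S × Ω)} (ω : Ω), MeasurableSet A →
      (((N ω).restrict B).map fun x => (x, ω)) A = (N ω).restrict B {x | (x, ω) ∈ A} :=
    fun ω hA => Measure.map_apply measurable_prodMk_right hA
  have hm : Measurable fun ω => ((N ω).restrict B).map fun x => (x, ω) := by
    refine Measure.measurable_of_measurable_coe _ fun A hA => ?_
    simp only [key _ hA]
    exact measurable_restrict_apply hN hB hfin hA
  rw [campbell, Measure.bind_apply hA hm.aemeasurable]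
  exact lintegral_congr fun ω => key ω hA

/-- **Campbell's formula with independent marks**: if the counts of the subsets of `Q` are
independent of the random element `Y`, then on `Q` the points and the mark `Y` decouple. -/
theorem IsPoissonProcess.campbell_eq_prod_of_indepFun (h : IsPoissonProcess P N Θ)
    [IsProbabilityMeasure P] {B Q : Set S} (hB : MeasurableSet B) (hQ : MeasurableSet Q)
    (hfin : ∀ ω, N ω B ≠ ∞) (hΘ : Θ B ≠ ∞) {Y : Ω → T} (hY : Measurable Y)
    (hind : ∀ A ⊆ Q ∩ B, MeasurableSet A → IndepFun (fun ω => N ω A) Y P) {H : Set (S × T)}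
    (hH : MeasurableSet H) :
    campbell P N B {p | p.1 ∈ Q ∧ (p.1, Y p.2) ∈ H} =
      (Θ.restrict B).prod P {p | p.1 ∈ Q ∧ (p.1, Y p.2) ∈ H} := by
  have hφ : Measurable fun p : S × Ω => (p.1, Y p.2) := by fun_prop
  have hQ' : MeasurableSet {p : S × Ω | p.1 ∈ Q} := hQ.preimage measurable_fst
  have : IsFiniteMeasure (Θ.restrict B) := ⟨by simpa using hΘ.lt_top⟩
  have := Measure.isProbabilityMeasure_map (μ := P) hY.aemeasurable
  have hset : {p : S × Ω | p.1 ∈ Q ∧ (p.1, Y p.2) ∈ H} =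
      (fun p : S × Ω => (p.1, Y p.2)) ⁻¹' H ∩ {p | p.1 ∈ Q} := by
    ext p; exact and_comm
  have conv : ∀ μ : Measure (S × Ω), μ {p : S × Ω | p.1 ∈ Q ∧ (p.1, Y p.2) ∈ H} =
      ((μ.restrict {p | p.1 ∈ Q}).map fun p : S × Ω => (p.1, Y p.2)) H := by
    intro μ
    rw [hset, Measure.map_apply hφ hH, Measure.restrict_apply (hφ hH)]
  rw [conv, conv]
  have e1 : ((campbell P N B).restrict {p | p.1 ∈ Q}).map (fun p : S × Ω => (p.1, Y p.2)) =
      ((Θ.restrict B).restrict Q).prod (P.map Y) := by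
    refine (Measure.prod_eq fun s t hs ht => ?_).symm
    rw [Measure.map_apply hφ (hs.prod ht), Measure.restrict_apply (hφ (hs.prod ht)),
      campbell_apply h.measurable hB hfin ((hφ (hs.prod ht)).inter hQ'),
      Measure.restrict_apply hs, Measure.restrict_apply (hs.inter hQ), Measure.map_apply hY ht]
    have hsQ : MeasurableSet (s ∩ Q ∩ B) := (hs.inter hQ).inter hB
    have hsub : s ∩ Q ∩ B ⊆ Q ∩ B := fun x hx => ⟨hx.1.2, hx.2⟩
    have e2 : ∀ ω, (N ω).restrict B {x | (x, ω) ∈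
        (fun p : S × Ω => (p.1, Y p.2)) ⁻¹' s ×ˢ t ∩ {p | p.1 ∈ Q}} =
        N ω (s ∩ Q ∩ B) * t.indicator 1 (Y ω) := by
      intro ω
      by_cases hω : Y ω ∈ t
      · have : {x | (x, ω) ∈ (fun p : S × Ω => (p.1, Y p.2)) ⁻¹' s ×ˢ t ∩ {p | p.1 ∈ Q}} =
            s ∩ Q := by
          ext x; simp [hω]
        rw [this, Measure.restrict_apply (hs.inter hQ), indicator_of_mem hω]
        simp
      · have : {x | (x, ω) ∈ (fun p : S × Ω => (p.1, Y p.2)) ⁻¹' s ×ˢ t ∩ {p | p.1 ∈ Q}} =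
            ∅ := by
          ext x; simp [hω]
        rw [this, indicator_of_notMem hω]
        simp
    simp_rw [e2]
    have hi : IndepFun (fun ω => N ω (s ∩ Q ∩ B)) (fun ω => t.indicator (1 : T → ℝ≥0∞) (Y ω)) P :=
      (hind _ hsub hsQ).comp measurable_id (measurable_one.indicator ht)
    have hmul := lintegral_mul_eq_lintegral_mul_lintegral_of_indepFun (h.measurable_count hsQ)
      ((measurable_one.indicator ht).comp hY) hi
    simp only [Pi.mul_apply, Function.comp_apply] at hmul
    rw [hmul, h.lintegral_count hsQ
      (measure_ne_top_of_subset (fun x hx => hx.2) hΘ)]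
    congr 1
    rw [← lintegral_indicator_one (hY ht)]
    rfl
  have e3 : (((Θ.restrict B).prod P).restrict {p | p.1 ∈ Q}).map (fun p : S × Ω => (p.1, Y p.2)) =
      ((Θ.restrict B).restrict Q).prod (P.map Y) := by
    have : {p : S × Ω | p.1 ∈ Q} = Q ×ˢ univ := by ext; simp
    rw [this, ← Measure.prod_restrict, Measure.restrict_univ]
    have := Measure.map_prod_map ((Θ.restrict B).restrict Q) P measurable_id hY
    rw [Measure.map_id] at this
    exact this.symm
  rw [e1, e3]

end Campbell

/-! ### Charged sections -/

section Charge

variable {T : Type*}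

/-- The pairs `(t, ν)` such that `ν` charges the section `G_t` of `G`. The section is exhausted by
bounded sets of finite `ν`-measure, so that this is a measurable set of pairs. -/
def chargeSet (G : Set (T × E n)) : Set (T × Measure (E n)) :=
  ⋃ k : ℕ, {p | p.2 (Metric.closedBall 0 k) ≠ ∞ ∧
    p.2 (Prod.mk p.1 ⁻¹' G ∩ Metric.closedBall 0 k) ≠ 0}

theorem measurableSet_chargeSet [MeasurableSpace T] {G : Set (T × E n)} (hG : MeasurableSet G) :
    MeasurableSet (chargeSet G) := by
  classical
  refine MeasurableSet.iUnion fun k => ?_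
  have hK : MeasurableSet (Metric.closedBall (0 : E n) k) := measurableSet_closedBall
  have hD : MeasurableSet {p : T × Measure (E n) | p.2 (Metric.closedBall 0 k) ≠ ∞} :=
    ((Measure.measurable_coe hK).comp measurable_snd) (measurableSet_singleton ∞).compl
  let κ : Kernel (T × Measure (E n)) (E n) := Kernel.piecewise hD
    (Kernel.restrict ⟨fun p : T × Measure (E n) => p.2, measurable_snd⟩ hK) 0
  have hκ : ∀ p, IsFiniteMeasure (κ p) := by
    intro p
    refine ⟨?_⟩
    simp only [κ, Kernel.piecewise_apply]
    split_ifs with hp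
    · rw [Kernel.restrict_apply, Measure.restrict_apply_univ]
      exact lt_top_iff_ne_top.2 hp
    · simp
  have hm := Kernel.measurable_kernel_prodMk_left_of_finite (κ := κ)
    (t := {q : (T × Measure (E n)) × E n | (q.1.1, q.2) ∈ G})
    (hG.preimage (by fun_prop)) hκ
  refine (hD.inter (hm (measurableSet_singleton 0).compl)).congr ?_
  ext p
  simp only [mem_inter_iff, mem_ofPred_eq, mem_preimage, mem_compl_iff, mem_singleton_iff]
  refine and_congr_right fun hp => ?_
  have : κ p = p.2.restrict (Metric.closedBall 0 k) := by
    simp only [κ, Kernel.piecewise_apply]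
    rw [if_pos (show p ∈ {p : T × Measure (E n) | p.2 (Metric.closedBall 0 k) ≠ ∞} from hp),
      Kernel.restrict_apply]
    rfl
  have hG' : Prod.mk p ⁻¹' {q : (T × Measure (E n)) × E n | (q.1.1, q.2) ∈ G} =
    Prod.mk p.1 ⁻¹' G := rfl
  rw [this, hG', Measure.restrict_apply (measurable_prodMk_left hG)]

theorem mem_chargeSet_iff {G : Set (T × E n)} {t : T} {ν : Measure (E n)}
    (hν : ∀ C, IsCompact C → ν C ≠ ∞) :
    (t, ν) ∈ chargeSet G ↔ ν (Prod.mk t ⁻¹' G) ≠ 0 := by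
  simp only [chargeSet, mem_iUnion, mem_ofPred_eq]
  constructor
  · rintro ⟨k, -, hk⟩ h0
    exact hk (measure_mono_null inter_subset_left h0)
  · intro h
    by_contra! hcon
    refine h ?_
    have : Prod.mk t ⁻¹' G = ⋃ k : ℕ, Prod.mk t ⁻¹' G ∩ Metric.closedBall 0 k := by
      rw [← inter_iUnion, Metric.iUnion_closedBall_nat, inter_univ]
    rw [this]
    exact measure_iUnion_null fun k => hcon k (hν _ (isCompact_closedBall _ _))

end Charge

/-! ### Slivnyak's theorem for void events -/

section Slivnyak

variable {Ω : Type*} [MeasurableSpace Ω] {P : Measure Ω} {θ : E n → Ω → Ω}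
  {N : Ω → Measure (E n)} {X : Ω → Measure (Hyperplane n)} {ℓ γ : ℝ}

/-- The pairs `(x, ω)` such that there is a data point `y ≠ x` in the cell of `x` with
`y - x ∈ S`. -/
def otherPointGraph (N : Ω → Measure (E n)) (X : Ω → Measure (Hyperplane n)) (S : Set (E n)) :
    Set (E n × Ω) :=
  {p | N p.2 (Prod.mk (p.1, X p.2) ⁻¹' cellGraph S \ {p.1}) ≠ 0}

/-- The Campbell measure and the product measure agree on the event that a point shares its cell
with another one. The space is partitioned into small pieces `Q`; a point in `Q` is independent of
the hyperplanes and of the points outside `Q`, and the event in question is the increasing limit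
of the events that there are such points outside the piece of the given point. -/
theorem campbell_otherPointGraph (h : IsCompressionModel P θ N X ℓ γ) {S : Set (E n)}
    (hS : MeasurableSet S) {B : Set (E n)} (hB : IsCompact B) :
    MeasurableSet (otherPointGraph N X S) ∧
    campbell P N B (otherPointGraph N X S) =
      ((ENNReal.ofReal ℓ • (volume : Measure (E n))).restrict B).prod P
        (otherPointGraph N X S) := by
  classical
  have := h.framework.isProbabilityMeasure
  have hBm : MeasurableSet B := hB.measurableSet
  set Θ : Measure (E n) := ENNReal.ofReal ℓ • volume with hΘ
  have hΘfin : ∀ C, IsCompact C → Θ C ≠ ∞ := fun C hC => by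
    rw [hΘ, Measure.smul_apply, smul_eq_mul]
    exact ENNReal.mul_ne_top ENNReal.ofReal_ne_top hC.measure_lt_top.ne
  have hXm := h.hyperplane_poisson.measurable
  have hNm := h.data_poisson.measurable
  have hG := measurableSet_cellGraph hS
  obtain ⟨A, hA, hsep⟩ := exists_seq_separating (E n) MeasurableSet.univ univ
  -- The pieces of the `m`-th partition, indexed by the patterns `s`.
  let Q : ∀ m : ℕ, (Fin m → Prop) → Set (E n) := fun m s => {y | ∀ i : Fin m, y ∈ A i ↔ s i}
  have hQ : ∀ m s, MeasurableSet (Q m s) := by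
    intro m s
    refine (MeasurableSet.iInter fun i : Fin m => ?_ :
      MeasurableSet (⋂ i : Fin m, {y | y ∈ A i ↔ s i})).congr (by ext y; simp [Q])
    by_cases hs : s i
    · exact (hA i).congr (by ext y; simp [hs])
    · exact (hA i).compl.congr (by ext y; simp [hs])
  let pat : ∀ m : ℕ, E n → Fin m → Prop := fun m x i => x ∈ A i
  have hmemQ : ∀ m x s, x ∈ Q m s ↔ pat m x = s := by
    intro m x s
    exact ⟨fun hx => funext fun i => propext (hx i), fun hx i => by rw [← hx]⟩
  let F : ℕ → Set (E n × Ω) := fun m => {p | N p.2 (Prod.mk (p.1, X p.2) ⁻¹' cellGraph S ∩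
    (Metric.closedBall 0 m \ Q m (pat m p.1))) ≠ 0}
  let H : Set (E n × (Measure (E n) × Measure (Hyperplane n))) :=
    {p | ((p.1, p.2.2), p.2.1) ∈ chargeSet (cellGraph S)}
  have hH : MeasurableSet H := (measurableSet_chargeSet hG).preimage (by fun_prop)
  let W : ∀ m : ℕ, (Fin m → Prop) → Set (E n) := fun m s => Metric.closedBall 0 m \ Q m s
  have hW : ∀ m s, MeasurableSet (W m s) := fun m s => measurableSet_closedBall.diff (hQ m s)
  let Y : ∀ m : ℕ, (Fin m → Prop) → Ω → Measure (E n) × Measure (Hyperplane n) :=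
    fun m s ω => ((N ω).restrict (W m s), X ω)
  have hres : ∀ m s, Measurable fun ω => (N ω).restrict (W m s) := fun m s =>
    (measurable_restrict_measure (hW m s)).comp hNm
  have hY : ∀ m s, Measurable (Y m s) := fun m s => (hres m s).prodMk hXm
  have hpiece : ∀ m s, F m ∩ {p | p.1 ∈ Q m s} =
      {p | p.1 ∈ Q m s ∧ (p.1, Y m s p.2) ∈ H} := by
    intro m s
    ext ⟨x, ω⟩
    rw [inter_comm]
    refine and_congr_right fun hx => ?_
    have hx' : pat m x = s := (hmemQ m x s).1 hx
    simp only [F, H, Y, mem_ofPred_eq]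
    rw [mem_chargeSet_iff, Measure.restrict_apply (measurable_prodMk_left hG), hx']
    intro C hC
    exact ((Measure.restrict_apply_le _ _).trans_lt (h.data_locallyFinite ω C hC).lt_top).ne
  have hpm : ∀ m s, MeasurableSet (F m ∩ {p | p.1 ∈ Q m s}) := by
    intro m s
    rw [hpiece]
    exact ((hQ m s).preimage measurable_fst).inter
      (hH.preimage (measurable_fst.prodMk ((hY m s).comp measurable_snd)))
  have hFU : ∀ m, F m = ⋃ s, F m ∩ {p | p.1 ∈ Q m s} := by
    intro m
    rw [← inter_iUnion]
    refine (inter_eq_left.2 fun (p : E n × Ω) _ =>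
      mem_iUnion.2 ⟨pat m p.1, (hmemQ m p.1 _).2 rfl⟩).symm
  have hFm : ∀ m, MeasurableSet (F m) := fun m => by
    rw [hFU m]
    exact MeasurableSet.iUnion fun s => hpm m s
  have hFeq : ∀ m, campbell P N B (F m) = (Θ.restrict B).prod P (F m) := by
    intro m
    have hdisj : Pairwise (Function.onFun Disjoint fun s => F m ∩ {p | p.1 ∈ Q m s}) := by
      intro s t hst
      refine Set.disjoint_left.2 fun p hp hq => hst ?_
      rw [← (hmemQ m p.1 s).1 hp.2, (hmemQ m p.1 t).1 hq.2]
    rw [hFU m, measure_iUnion hdisj (hpm m), measure_iUnion hdisj (hpm m)]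
    refine tsum_congr fun s => ?_
    rw [hpiece]
    refine h.data_poisson.campbell_eq_prod_of_indepFun hBm (hQ m s)
      (fun ω => h.data_locallyFinite ω B hB) (hΘfin B hB) (hY m s) (fun D hD hDm => ?_) hH
    have hdis : Disjoint D (W m s) :=
      Set.disjoint_left.2 fun x hx hxW => hxW.2 (hD hx).1
    have hi := h.data_poisson.indepFun_restrict hDm (hW m s)
      (measure_ne_top_of_subset (fun x hx => (hD hx).2) (hΘfin B hB))
      (measure_ne_top_of_subset sdiff_subset (hΘfin _ (isCompact_closedBall _ _))) hdis
    refine indepFun_prodMk_of_indepFun (h.data_poisson.measurable_count hDm) (hres m s) hXm ?_ hi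
    exact h.indep.comp (φ := fun ν : Measure (E n) => (ν D, ν.restrict (W m s)))
      ((Measure.measurable_coe hDm).prodMk (measurable_restrict_measure (hW m s))) measurable_id
  have hmono : Monotone F := by
    intro m m' hmm' p hp
    refine fun h0 => hp (measure_mono_null (inter_subset_inter_right _ ?_) h0)
    refine sdiff_subset_sdiff (Metric.closedBall_subset_closedBall (by exact_mod_cast hmm')) ?_
    intro y hy i
    exact hy ⟨i, i.2.trans_le hmm'⟩
  have hunion : otherPointGraph N X S = ⋃ m, F m := by
    ext p
    simp only [mem_iUnion, otherPointGraph, mem_ofPred_eq, F]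
    constructor
    · intro hp
      by_contra! hcon
      refine hp (measure_mono_null (t := ⋃ m : ℕ, Prod.mk (p.1, X p.2) ⁻¹' cellGraph S ∩
        (Metric.closedBall 0 m \ Q m (pat m p.1))) (fun y hy => ?_) (measure_iUnion_null hcon))
      have hne : ∃ i, ¬ (y ∈ A i ↔ p.1 ∈ A i) := by
        by_contra! hall
        exact hy.2 (hsep y (mem_univ _) _ (mem_univ _) hall)
      obtain ⟨i, hi⟩ := hne
      obtain ⟨k, hk⟩ := exists_nat_ge ‖y‖
      have hik : i < max k (i + 1) := by omega
      refine mem_iUnion.2 ⟨max k (i + 1), hy.1, ?_, fun hyQ =>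
        hi ((hyQ : ∀ j : Fin (max k (i + 1)), y ∈ A j ↔ p.1 ∈ A j) ⟨i, hik⟩)⟩
      rw [mem_closedBall_zero_iff]
      exact hk.trans (by exact_mod_cast le_max_left _ _)
    · rintro ⟨m, hm⟩ h0
      refine hm (measure_mono_null (t := Prod.mk (p.1, X p.2) ⁻¹' cellGraph S \ {p.1})
        (fun y hy => ⟨hy.1, ?_⟩) h0)
      rintro rfl
      exact hy.2.2 ((hmemQ m _ _).2 rfl)
  refine ⟨by rw [hunion]; exact MeasurableSet.iUnion hFm, ?_⟩
  rw [hunion, hmono.measure_iUnion, hmono.measure_iUnion]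
  simp_rw [hFeq]

/-- The event that some data point other than the origin lies in the part of the zero cell in
`S`. -/
def otherDataEvent (N : Ω → Measure (E n)) (X : Ω → Measure (Hyperplane n)) (S : Set (E n)) :
    Set Ω :=
  {ω | N ω ((zeroCell (X ω) ∩ S) \ {0}) ≠ 0}

theorem mem_otherPointGraph_iff (h : IsCompressionModel P θ N X ℓ γ) {S : Set (E n)}
    (hS : MeasurableSet S) {x : E n} {ω : Ω} :
    (x, ω) ∈ otherPointGraph N X S ↔ θ x ω ∈ otherDataEvent N X S := by
  have hc := h.hyperplane_poisson.counting
  have hcell : ∀ y, ((x, X ω), y) ∈ cellGraph S ↔ y - x ∈ zeroCell (X (θ x ω)) ∩ S := by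
    intro y
    rw [mem_cellGraph_iff (hc ω) (h.hyperplane_locallyFinite ω) (by
      rw [← h.hyperplane_compatible]; exact hc _), h.hyperplane_compatible]
  simp only [otherPointGraph, otherDataEvent, mem_ofPred_eq]
  have hpre : (fun y => y - x) ⁻¹' ((zeroCell (X (θ x ω)) ∩ S) \ {0}) =
      Prod.mk (x, X ω) ⁻¹' cellGraph S \ {x} := by
    ext y
    simp only [mem_preimage, Set.mem_sdiff, mem_singleton_iff, sub_eq_zero]
    rw [← hcell]
  have hzm : MeasurableSet (zeroCell (X (θ x ω))) := isClosed_closure.measurableSet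
  rw [h.data_compatible, Measure.map_apply (by fun_prop)
    ((hzm.inter hS).diff (measurableSet_singleton 0)), hpre]

theorem measurableSet_otherDataEvent (h : IsCompressionModel P θ N X ℓ γ) {S : Set (E n)}
    (hS : MeasurableSet S) : MeasurableSet (otherDataEvent N X S) := by
  have h1 := (campbell_otherPointGraph h hS (isCompact_unitCube n)).1
  refine (h1.preimage (measurable_prodMk_left (x := (0 : E n)))).congr ?_
  ext ω
  rw [mem_preimage, mem_otherPointGraph_iff h hS, h.framework.zero]

theorem volume_unitCube (n : ℕ) : volume (unitCube n) = 1 := by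
  have h := (EuclideanSpace.volume_preserving_symm_measurableEquiv_toLp (Fin n)).symm
  have h2 : unitCube n = (MeasurableEquiv.toLp 2 (Fin n → ℝ)).symm ⁻¹'
      (Set.pi univ fun _ => Icc (0 : ℝ) 1) := by
    ext x
    simp [unitCube, Pi.le_def, forall_and]
  rw [h2, (EuclideanSpace.volume_preserving_symm_measurableEquiv_toLp (Fin n)).measure_preimage_equiv,
    volume_pi_pi]
  simp

/-- **Slivnyak's theorem** for the events `otherDataEvent`: the additional point at the origin
under the Palm probability does not affect the other data. -/
theorem palm_otherDataEvent (h : IsCompressionModel P θ N X ℓ γ) (hℓ : 0 < ℓ) {S : Set (E n)}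
    (hS : MeasurableSet S) : palm P θ N ℓ (otherDataEvent N X S) = P (otherDataEvent N X S) := by
  have := h.framework.isProbabilityMeasure
  have hB := isCompact_unitCube n
  obtain ⟨hGm, hG⟩ := campbell_otherPointGraph h hS hB
  have hA := measurableSet_otherDataEvent h hS
  have hθ : ∀ ω, Measurable fun x => θ x ω := fun ω =>
    h.framework.measurable.comp (measurable_id.prodMk measurable_const)
  have e1 : ∫⁻ ω, (∫⁻ x in unitCube n, (otherDataEvent N X S).indicator 1 (θ x ω) ∂(N ω)) ∂P =
      campbell P N (unitCube n) (otherPointGraph N X S) := by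
    rw [campbell_apply h.data_poisson.measurable hB.measurableSet
      (fun ω => h.data_locallyFinite ω _ hB) hGm]
    refine lintegral_congr fun ω => ?_
    have : {x | (x, ω) ∈ otherPointGraph N X S} = (fun x => θ x ω) ⁻¹' otherDataEvent N X S := by
      ext x
      exact mem_otherPointGraph_iff h hS
    rw [this, ← lintegral_indicator_one (hθ ω hA)]
    rfl
  rw [palm_apply h hA, e1, hG]
  have hfin : IsFiniteMeasure ((ENNReal.ofReal ℓ • (volume : Measure (E n))).restrict
      (unitCube n)) := ⟨by simp [volume_unitCube]⟩
  rw [Measure.prod_apply hGm]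
  have e2 : ∀ x : E n, P (Prod.mk x ⁻¹' otherPointGraph N X S) = P (otherDataEvent N X S) := by
    intro x
    have : Prod.mk x ⁻¹' otherPointGraph N X S = θ x ⁻¹' otherDataEvent N X S := by
      ext ω
      exact mem_otherPointGraph_iff h hS
    rw [this, (h.framework.measurePreserving x).measure_preimage hA.nullMeasurableSet]
  simp_rw [e2]
  rw [lintegral_const, Measure.restrict_apply_univ, Measure.smul_apply, volume_unitCube,
    smul_eq_mul, mul_one, mul_comm (P _), ← mul_assoc, ENNReal.inv_mul_cancel, one_mul]
  · simpa using hℓ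
  · exact ENNReal.ofReal_ne_top

end Slivnyak

/-! ### Polar coordinates and the intensity of hyperplanes hitting a segment -/

section Polar

theorem lintegral_volumeIoiPow (k : ℕ) {f : ℝ → ℝ≥0∞} (hf : Measurable f) :
    ∫⁻ s, f s ∂(Measure.volumeIoiPow k) = ∫⁻ s in Ioi (0 : ℝ), ENNReal.ofReal (s ^ k) * f s := by
  have hf' : Measurable fun s : Ioi (0 : ℝ) => f s := hf.comp measurable_subtype_coe
  rw [Measure.volumeIoiPow, lintegral_withDensity_eq_lintegral_mul _ (by fun_prop) hf']
  exact lintegral_subtype_comap measurableSet_Ioi fun s => ENNReal.ofReal (s ^ k) * f s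

/-- Integration in polar coordinates. -/
theorem lintegral_polar [NeZero n] {F : E n → ℝ≥0∞} (hF : Measurable F) :
    ∫⁻ x, F x = ∫⁻ u : Metric.sphere (0 : E n) 1, ∫⁻ s in Ioi (0 : ℝ),
      ENNReal.ofReal (s ^ (n - 1)) * F (s • (u : E n)) ∂volume
        ∂(volume : Measure (E n)).toSphere := by
  have hmp := (volume : Measure (E n)).measurePreserving_homeomorphUnitSphereProd
  rw [finrank_euclideanSpace_fin] at hmp
  have hG : Measurable fun p : Metric.sphere (0 : E n) 1 × Ioi (0 : ℝ) =>
      F ((p.2 : ℝ) • (p.1 : E n)) := hF.comp (by fun_prop)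
  have h1 : ∫⁻ x, F x = ∫⁻ x : ({0}ᶜ : Set (E n)), F x
      ∂((volume : Measure (E n)).comap Subtype.val) := by
    rw [lintegral_subtype_comap (measurableSet_singleton _).compl, restrict_compl_singleton]
  have h2 := hmp.lintegral_comp hG
  have h3 : ∀ x : ({0}ᶜ : Set (E n)), F ((((homeomorphUnitSphereProd (E n)) x).2 : ℝ) •
      (((homeomorphUnitSphereProd (E n)) x).1 : E n)) = F x := by
    intro x
    have := congrArg Subtype.val ((homeomorphUnitSphereProd (E n)).symm_apply_apply x)
    rw [homeomorphUnitSphereProd_symm_apply_coe] at this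
    rw [this]
  simp_rw [h3] at h2
  rw [h1, h2, lintegral_prod _ hG.aemeasurable]
  refine lintegral_congr fun u => ?_
  exact lintegral_volumeIoiPow (n - 1) (f := fun s => F (s • (u : E n))) (hF.comp (by fun_prop))

theorem lintegral_radial [NeZero n] {f : ℝ → ℝ≥0∞} (hf : Measurable f) :
    ∫⁻ x : E n, f ‖x‖ = n * volume (Metric.ball (0 : E n) 1) *
      ∫⁻ s in Ioi (0 : ℝ), ENNReal.ofReal (s ^ (n - 1)) * f s := by
  have hf' : Measurable fun x : E n => f ‖x‖ := hf.comp measurable_norm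
  rw [lintegral_polar hf']
  have : ∀ u : Metric.sphere (0 : E n) 1, ∫⁻ s in Ioi (0 : ℝ),
      ENNReal.ofReal (s ^ (n - 1)) * f ‖s • (u : E n)‖ =
      ∫⁻ s in Ioi (0 : ℝ), ENNReal.ofReal (s ^ (n - 1)) * f s := by
    intro u
    refine setLIntegral_congr_fun measurableSet_Ioi fun s hs => ?_
    simp only [norm_smul, mem_sphere_zero_iff_norm.1 u.2, mul_one, Real.norm_of_nonneg (le_of_lt hs)]
  simp_rw [this]
  rw [lintegral_const, Measure.toSphere_apply_univ, finrank_euclideanSpace_fin, mul_comm]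

/-- The volume of the unit ball. -/
noncomputable def ballVolume (n : ℕ) : ℝ := √Real.pi ^ n / Real.Gamma (n / 2 + 1)

theorem ballVolume_pos (n : ℕ) : 0 < ballVolume n := by
  have : 0 < Real.Gamma (n / 2 + 1) := Real.Gamma_pos_of_pos (by positivity)
  have := Real.pi_pos
  unfold ballVolume
  positivity

theorem volume_unitBall [NeZero n] :
    volume (Metric.ball (0 : E n) 1) = ENNReal.ofReal (ballVolume n) := by
  rw [EuclideanSpace.volume_ball]
  simp [ballVolume]

theorem volume_closedBall_eq [NeZero n] {r : ℝ} (hr : 0 ≤ r) :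
    volume (Metric.closedBall (0 : E n) r) = ENNReal.ofReal (ballVolume n * r ^ n) := by
  rw [EuclideanSpace.volume_closedBall, ← ENNReal.ofReal_pow hr, ← ENNReal.ofReal_mul (by positivity)]
  simp [ballVolume, mul_comm]

theorem integral_max_mul_exp_neg_sq : ∫ t : ℝ, max t 0 * Real.exp (-t ^ 2) = 1 / 2 := by
  have h1 : (fun t : ℝ => max t 0 * Real.exp (-t ^ 2)) =
      (Ioi (0 : ℝ)).indicator fun t => t ^ (1 : ℝ) * Real.exp (-t ^ (2 : ℝ)) := by
    ext t
    by_cases ht : 0 < t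
    · rw [indicator_of_mem (mem_Ioi.2 ht), max_eq_left ht.le]
      simp
    · rw [indicator_of_notMem (by simpa using ht), max_eq_right (not_lt.1 ht), zero_mul]
  rw [h1, integral_indicator measurableSet_Ioi,
    integral_rpow_mul_exp_neg_rpow (by norm_num) (by norm_num)]
  norm_num

theorem integrable_max_mul_exp_neg_sq :
    Integrable fun t : ℝ => max t 0 * Real.exp (-t ^ 2) := by
  by_contra h
  have := integral_max_mul_exp_neg_sq
  rw [integral_undef h] at this
  norm_num at this

theorem integrable_exp_neg_sq : Integrable fun t : ℝ => Real.exp (-t ^ 2) := by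
  simpa using integrable_exp_neg_mul_sq one_pos

theorem lintegral_coord_gaussian [NeZero n] :
    ∫⁻ x : E n, ENNReal.ofReal (x 0) * ENNReal.ofReal (Real.exp (-‖x‖ ^ 2)) =
      ENNReal.ofReal (√Real.pi ^ (n - 1) / 2) := by
  let f : Fin n → ℝ → ℝ := fun i t =>
    if i = 0 then max t 0 * Real.exp (-t ^ 2) else Real.exp (-t ^ 2)
  have hfi : ∀ i, Integrable (f i) := by
    intro i
    by_cases hi : i = 0
    · simpa [f, hi] using integrable_max_mul_exp_neg_sq
    · simpa [f, hi] using integrable_exp_neg_sq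
  have hprod : ∀ x : Fin n → ℝ, ∏ i, f i (x i) = max (x 0) 0 * Real.exp (-∑ i, x i ^ 2) := by
    intro x
    have : ∀ i, f i (x i) = (if i = 0 then max (x 0) 0 else 1) * Real.exp (-x i ^ 2) := by
      intro i
      by_cases hi : i = 0
      · simp [f, hi]
      · simp [f, hi]
    simp_rw [this, Finset.prod_mul_distrib, ← Real.exp_sum, Finset.sum_neg_distrib]
    simp
  have hval : ∫ x : Fin n → ℝ, ∏ i, f i (x i) = √Real.pi ^ (n - 1) / 2 := by
    rw [integral_fintype_prod_volume_eq_prod]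
    have : ∀ i, ∫ t, f i t = if i = 0 then 1 / 2 else √Real.pi := by
      intro i
      by_cases hi : i = 0
      · simpa [f, hi] using integral_max_mul_exp_neg_sq
      · simpa [f, hi] using integral_gaussian 1
    simp_rw [this]
    rw [Finset.prod_ite, Finset.prod_const, Finset.prod_const, Finset.filter_eq', if_pos (by simp),
      Finset.filter_ne', Finset.card_erase_of_mem (by simp)]
    simp
    ring
  have hint : Integrable fun x : Fin n → ℝ => ∏ i, f i (x i) := Integrable.fintype_prod hfi
  rw [← hval, ofReal_integral_eq_lintegral_ofReal hint (ae_of_all _ fun x => by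
    simp only [hprod, Pi.zero_apply]; positivity)]
  have hmp := PiLp.volume_preserving_ofLp (Fin n)
  rw [← hmp.lintegral_comp (f := fun x => ENNReal.ofReal (∏ i, f i (x i)))
    (by simp_rw [hprod]; fun_prop)]
  refine lintegral_congr fun x => ?_
  rw [hprod, ENNReal.ofReal_mul (le_max_right _ _), EuclideanSpace.real_norm_sq_eq]
  congr 1
  simp [ENNReal.ofReal_max]

theorem lintegral_inner_gaussian [NeZero n] (y : E n) :
    ∫⁻ x : E n, ENNReal.ofReal ⟪y, x⟫ * ENNReal.ofReal (Real.exp (-‖x‖ ^ 2)) =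
      ENNReal.ofReal ‖y‖ * ENNReal.ofReal (√Real.pi ^ (n - 1) / 2) := by
  -- A reflection maps `y` to a multiple of the first unit vector.
  let w : E n := ‖y‖ • EuclideanSpace.single 0 1
  have hw : ‖w‖ = ‖y‖ := by simp [w, norm_smul]
  let R := (ℝ ∙ (w - y))ᗮ.reflection
  have hR : R w = y := Submodule.reflection_sub hw
  have hmp := R.measurePreserving
  rw [← hmp.lintegral_comp (by fun_prop), ← lintegral_coord_gaussian,
    ← lintegral_const_mul _ (by fun_prop)]
  refine lintegral_congr fun x => ?_
  rw [← hR, LinearIsometryEquiv.inner_map_map, LinearIsometryEquiv.norm_map,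
    LinearIsometryEquiv.norm_map, hw, ← mul_assoc, ← ENNReal.ofReal_mul (norm_nonneg _)]
  congr 2
  simp [w, real_inner_smul_left, EuclideanSpace.inner_single_left]

/-- The mean of the positive part of a coordinate of a uniform random unit vector. -/
noncomputable def halfMean (n : ℕ) : ℝ :=
  Real.Gamma (n / 2 + 1) / (n * √Real.pi * Real.Gamma ((n + 1) / 2))

theorem halfMean_pos [NeZero n] : 0 < halfMean n := by
  have : 0 < Real.Gamma (n / 2 + 1) := Real.Gamma_pos_of_pos (by positivity)
  have : 0 < Real.Gamma ((n + 1) / 2) := Real.Gamma_pos_of_pos (by positivity)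
  have : (0 : ℝ) < n := by exact_mod_cast NeZero.pos n
  have := Real.pi_pos
  unfold halfMean
  positivity

theorem lintegral_inner_toSphere [NeZero n] (y : E n) :
    ∫⁻ u : Metric.sphere (0 : E n) 1, ENNReal.ofReal ⟪y, (u : E n)⟫
      ∂(volume : Measure (E n)).toSphere =
      ENNReal.ofReal (‖y‖ * (√Real.pi ^ (n - 1) / Real.Gamma ((n + 1) / 2))) := by
  have hΓ : 0 < Real.Gamma ((n + 1 : ℝ) / 2) := Real.Gamma_pos_of_pos (by positivity)
  have hn1 : n - 1 + 1 = n := Nat.sub_add_cancel (NeZero.pos n)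
  have h := lintegral_inner_gaussian y
  rw [lintegral_polar (by fun_prop)] at h
  have hint : IntegrableOn (fun s : ℝ => s ^ (n : ℝ) * Real.exp (-s ^ (2 : ℝ))) (Ioi 0) :=
    integrableOn_rpow_mul_exp_neg_rpow (by have := NeZero.pos n; linarith [Nat.cast_nonneg (α := ℝ) n])
      (by norm_num)
  have h1 : ∫⁻ s in Ioi (0 : ℝ), ENNReal.ofReal (s ^ n * Real.exp (-s ^ 2)) =
      ENNReal.ofReal (1 / 2 * Real.Gamma ((n + 1) / 2)) := by
    have := integral_rpow_mul_exp_neg_rpow (p := 2) (q := n) (by norm_num)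
      (by linarith [Nat.cast_nonneg (α := ℝ) n])
    rw [← this, ofReal_integral_eq_lintegral_ofReal hint]
    · refine setLIntegral_congr_fun measurableSet_Ioi fun s _ => ?_
      simp
    · refine (ae_restrict_iff' measurableSet_Ioi).2 (ae_of_all _ fun s hs => ?_)
      have : (0 : ℝ) < s := hs
      simp only [Pi.zero_apply]
      positivity
  have h2 : ∀ u : Metric.sphere (0 : E n) 1, ∫⁻ s in Ioi (0 : ℝ), ENNReal.ofReal (s ^ (n - 1)) *
      (ENNReal.ofReal ⟪y, s • (u : E n)⟫ * ENNReal.ofReal (Real.exp (-‖s • (u : E n)‖ ^ 2))) =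
      ENNReal.ofReal ⟪y, (u : E n)⟫ * ENNReal.ofReal (1 / 2 * Real.Gamma ((n + 1) / 2)) := by
    intro u
    rw [← h1, ← lintegral_const_mul _ (by fun_prop)]
    refine setLIntegral_congr_fun measurableSet_Ioi fun s hs => ?_
    have hs' : (0 : ℝ) < s := hs
    simp only [norm_smul, mem_sphere_zero_iff_norm.1 u.2, mul_one, Real.norm_of_nonneg hs'.le,
      real_inner_smul_right]
    rw [ENNReal.ofReal_mul hs'.le, ENNReal.ofReal_mul (by positivity : (0 : ℝ) ≤ s ^ n)]
    have : s ^ n = s ^ (n - 1) * s := by rw [← pow_succ, hn1]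
    rw [this, ENNReal.ofReal_mul (by positivity)]
    ring
  simp_rw [h2] at h
  rw [lintegral_mul_const _ (by fun_prop)] at h
  have hne : ENNReal.ofReal (1 / 2 * Real.Gamma ((n + 1) / 2)) ≠ 0 := by
    simpa using hΓ
  rw [← ENNReal.mul_left_inj hne ENNReal.ofReal_ne_top, h, ← ENNReal.ofReal_mul (norm_nonneg _),
    ← ENNReal.ofReal_mul (by positivity)]
  congr 1
  field_simp

theorem lintegral_inner_sphereUniform [NeZero n] (y : E n) :
    ∫⁻ u : Metric.sphere (0 : E n) 1, ENNReal.ofReal ⟪y, (u : E n)⟫ ∂(sphereUniform n) =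
      ENNReal.ofReal (halfMean n * ‖y‖) := by
  have hn : (0 : ℝ) < n := by exact_mod_cast NeZero.pos n
  have hn1 : n - 1 + 1 = n := Nat.sub_add_cancel (NeZero.pos n)
  have hΓ1 : 0 < Real.Gamma (n / 2 + 1 : ℝ) := Real.Gamma_pos_of_pos (by positivity)
  have hΓ2 : 0 < Real.Gamma ((n + 1) / 2 : ℝ) := Real.Gamma_pos_of_pos (by positivity)
  have hπ := Real.pi_pos
  rw [sphereUniform, lintegral_smul_measure, lintegral_inner_toSphere,
    Measure.toSphere_apply_univ, finrank_euclideanSpace_fin, volume_unitBall,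
    ← ENNReal.ofReal_natCast, ← ENNReal.ofReal_mul hn.le,
    ← ENNReal.ofReal_inv_of_pos (mul_pos hn (ballVolume_pos n)), smul_eq_mul,
    ← ENNReal.ofReal_mul (inv_nonneg.2 (mul_pos hn (ballVolume_pos n)).le)]
  congr 1
  have : √Real.pi ^ n = √Real.pi ^ (n - 1) * √Real.pi := by rw [← pow_succ, hn1]
  rw [ballVolume, halfMean, this]
  field_simp

instance : SFinite (sphereUniform n) := by unfold sphereUniform; infer_instance

/-- The intensity measure of the hyperplanes that hit the segment from the origin to `y`. -/
theorem hyperplaneIntensity_hit_segment [NeZero n] {γ : ℝ} (hγ : 0 < γ) (y : E n) :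
    hyperplaneIntensity n γ (Hyperplane.hit (segment ℝ 0 y)) =
      ENNReal.ofReal (2 * γ * halfMean n * ‖y‖) := by
  have hm : MeasurableSet (Hyperplane.hit (segment ℝ 0 y)) :=
    Hyperplane.measurableSet_hit (isCompact_segment 0 y)
  rw [hyperplaneIntensity, Measure.smul_apply, Measure.map_apply Hyperplane.measurable_ofNormal hm,
    Measure.prod_apply (Hyperplane.measurable_ofNormal hm), smul_eq_mul, mul_assoc (2 * γ),
    ENNReal.ofReal_mul (by positivity : (0 : ℝ) ≤ 2 * γ), ← lintegral_inner_sphereUniform]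
  congr 1
  refine lintegral_congr fun u => ?_
  rw [Measure.restrict_apply (measurable_prodMk_left (Hyperplane.measurable_ofNormal hm))]
  have : Prod.mk u ⁻¹' (Hyperplane.ofNormal ⁻¹' Hyperplane.hit (segment ℝ 0 y)) ∩ Ioi (0 : ℝ) =
      Ioc 0 ⟪y, (u : E n)⟫ := by
    ext τ
    simp only [mem_inter_iff, mem_preimage, Hyperplane.hit, Hyperplane.ofNormal,
      mem_Ioi, mem_Ioc]
    constructor
    · rintro ⟨⟨x, hx, hxs⟩, hτ⟩
      refine ⟨hτ, ?_⟩
      rw [segment_eq_image] at hxs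
      obtain ⟨s, hs, rfl⟩ := hxs
      simp only [mem_ofPred_eq, smul_zero, zero_add, real_inner_smul_left] at hx
      rw [← hx] at hτ ⊢
      have hpos : 0 < ⟪y, (u : E n)⟫ := by
        by_contra! hneg
        linarith [mul_nonpos_of_nonneg_of_nonpos hs.1 hneg]
      exact mul_le_of_le_one_left hpos.le hs.2
    · rintro ⟨hτ, hle⟩
      refine ⟨⟨(τ / ⟪y, (u : E n)⟫) • y, ?_, ?_⟩, hτ⟩
      · have : ⟪y, (u : E n)⟫ ≠ 0 := (hτ.trans_le hle).ne'
        simp only [mem_ofPred_eq, real_inner_smul_left]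
        field_simp
      · rw [segment_eq_image]
        exact ⟨τ / ⟪y, (u : E n)⟫, ⟨div_nonneg hτ.le (hτ.le.trans hle),
          div_le_one_of_le₀ hle (hτ.le.trans hle)⟩, by simp⟩
  rw [this, Real.volume_Ioc, sub_zero]

end Polar

/-! ### Exponential integrals over balls and their complements -/

section Radial

/-- For `0 < s`, the function `s ^ k` lies below its exponential comparison function at `r`. -/
theorem pow_le_pow_mul_exp {s r : ℝ} (hs : 0 < s) (hr : 0 < r) (k : ℕ) :
    s ^ k ≤ r ^ k * Real.exp (k * ((s - r) / r)) := by
  have h1 : s / r ≤ Real.exp ((s - r) / r) := by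
    have := Real.add_one_le_exp ((s - r) / r)
    have h2 : (s - r) / r + 1 = s / r := by field_simp; ring
    linarith
  have h3 : s = r * (s / r) := by field_simp
  calc s ^ k = r ^ k * (s / r) ^ k := by rw [← mul_pow, ← h3]
    _ ≤ r ^ k * Real.exp ((s - r) / r) ^ k := by gcongr
    _ = _ := by rw [← Real.exp_nat_mul]

theorem lintegral_closedBall_exp_le [NeZero n] {g r : ℝ} (hr : 0 < r) (hgr : g * r ≤ n - 1) :
    ∫⁻ x in Metric.closedBall (0 : E n) r, ENNReal.ofReal (Real.exp (-(g * ‖x‖))) ≤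
      ENNReal.ofReal (n * (ballVolume n * r ^ n * Real.exp (-(g * r)))) := by
  have hn1 : n - 1 + 1 = n := Nat.sub_add_cancel (NeZero.pos n)
  have hn1' : ((n - 1 : ℕ) : ℝ) = n - 1 := by rw [Nat.cast_pred (NeZero.pos n)]
  let f : ℝ → ℝ≥0∞ := (Iic r).indicator fun s => ENNReal.ofReal (Real.exp (-(g * s)))
  have hf : Measurable f := by
    refine Measurable.indicator (by fun_prop) measurableSet_Iic
  have h1 : ∫⁻ x in Metric.closedBall (0 : E n) r, ENNReal.ofReal (Real.exp (-(g * ‖x‖))) =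
      ∫⁻ x : E n, f ‖x‖ := by
    rw [← lintegral_indicator measurableSet_closedBall]
    refine lintegral_congr fun x => ?_
    simp [f, indicator]
  have h2 : ∀ s ∈ Ioi (0 : ℝ), ENNReal.ofReal (s ^ (n - 1)) * f s ≤
      (Ioc 0 r).indicator (fun _ => ENNReal.ofReal (r ^ (n - 1) * Real.exp (-(g * r)))) s := by
    intro s hs
    have hs' : 0 < s := hs
    by_cases hsr : s ≤ r
    · simp only [f]
      rw [indicator_of_mem (mem_Iic.2 hsr), indicator_of_mem (mem_Ioc.2 ⟨hs', hsr⟩),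
        ← ENNReal.ofReal_mul (by positivity)]
      refine ENNReal.ofReal_le_ofReal ?_
      calc s ^ (n - 1) * Real.exp (-(g * s))
          ≤ r ^ (n - 1) * Real.exp (((n - 1 : ℕ) : ℝ) * ((s - r) / r)) * Real.exp (-(g * s)) := by
            gcongr; exact pow_le_pow_mul_exp hs' hr _
        _ = r ^ (n - 1) * Real.exp (((n - 1 : ℕ) : ℝ) * ((s - r) / r) - g * s) := by
            rw [mul_assoc, ← Real.exp_add, ← sub_eq_add_neg]
        _ ≤ r ^ (n - 1) * Real.exp (-(g * r)) := by
            gcongr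
            rw [hn1']
            have h3 : (n - 1 : ℝ) * ((s - r) / r) ≤ g * r * ((s - r) / r) :=
              mul_le_mul_of_nonpos_right hgr (div_nonpos_of_nonpos_of_nonneg (by linarith) hr.le)
            have h4 : g * r * ((s - r) / r) = g * s - g * r := by field_simp
            linarith
    · simp [f, hsr]
  rw [h1, lintegral_radial hf]
  calc (n : ℝ≥0∞) * volume (Metric.ball (0 : E n) 1) *
        ∫⁻ s in Ioi (0 : ℝ), ENNReal.ofReal (s ^ (n - 1)) * f s
      ≤ n * volume (Metric.ball (0 : E n) 1) * ∫⁻ s in Ioi (0 : ℝ),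
        (Ioc 0 r).indicator (fun _ => ENNReal.ofReal (r ^ (n - 1) * Real.exp (-(g * r)))) s := by
        gcongr 1
        exact setLIntegral_mono' measurableSet_Ioi h2
    _ = n * volume (Metric.ball (0 : E n) 1) *
        (ENNReal.ofReal (r ^ (n - 1) * Real.exp (-(g * r))) * ENNReal.ofReal r) := by
        rw [setLIntegral_indicator measurableSet_Ioc, inter_eq_left.2 Ioc_subset_Ioi_self,
          setLIntegral_const, Real.volume_Ioc, sub_zero]
    _ = _ := by
        have hb := ballVolume_pos n
        rw [volume_unitBall, ← ENNReal.ofReal_natCast, ← ENNReal.ofReal_mul (by positivity),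
          ← ENNReal.ofReal_mul (by positivity), ← ENNReal.ofReal_mul (by positivity)]
        congr 1
        have : r ^ n = r ^ (n - 1) * r := by rw [← pow_succ, hn1]
        rw [this]
        ring

theorem lintegral_compl_ball_exp_le [NeZero n] {g r ε : ℝ} (hg : 0 < g) (hr : 0 < r) (hε : 0 < ε)
    (hgr : (n - 1 : ℝ) ≤ (1 - ε) * (g * r)) :
    ∫⁻ x in (Metric.ball (0 : E n) r)ᶜ, ENNReal.ofReal (Real.exp (-(g * ‖x‖))) ≤
      ENNReal.ofReal (n / (ε * (g * r)) * (ballVolume n * r ^ n * Real.exp (-(g * r)))) := by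
  have hn1 : n - 1 + 1 = n := Nat.sub_add_cancel (NeZero.pos n)
  have hn1' : ((n - 1 : ℕ) : ℝ) = n - 1 := by rw [Nat.cast_pred (NeZero.pos n)]
  let f : ℝ → ℝ≥0∞ := (Ici r).indicator fun s => ENNReal.ofReal (Real.exp (-(g * s)))
  have hf : Measurable f := Measurable.indicator (by fun_prop) measurableSet_Ici
  have h1 : ∫⁻ x in (Metric.ball (0 : E n) r)ᶜ, ENNReal.ofReal (Real.exp (-(g * ‖x‖))) =
      ∫⁻ x : E n, f ‖x‖ := by
    rw [← lintegral_indicator measurableSet_ball.compl]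
    refine lintegral_congr fun x => ?_
    simp [f, indicator]
  -- Part of the exponential decay makes up for the growth of the power, the rest is integrated.
  have h2 : ∀ s ∈ Ioi (0 : ℝ), ENNReal.ofReal (s ^ (n - 1)) * f s ≤
      (Ici r).indicator (fun s => ENNReal.ofReal (r ^ (n - 1) * Real.exp (-(g * r)) *
        Real.exp (ε * g * r)) * ENNReal.ofReal (Real.exp (-(ε * g) * s))) s := by
    intro s hs
    have hs' : 0 < s := hs
    by_cases hsr : r ≤ s
    · simp only [f]
      rw [indicator_of_mem (mem_Ici.2 hsr), indicator_of_mem (mem_Ici.2 hsr),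
        ← ENNReal.ofReal_mul (by positivity), ← ENNReal.ofReal_mul (by positivity)]
      refine ENNReal.ofReal_le_ofReal ?_
      calc s ^ (n - 1) * Real.exp (-(g * s))
          ≤ r ^ (n - 1) * Real.exp (((n - 1 : ℕ) : ℝ) * ((s - r) / r)) * Real.exp (-(g * s)) := by
            gcongr; exact pow_le_pow_mul_exp hs' hr _
        _ = r ^ (n - 1) * Real.exp (((n - 1 : ℕ) : ℝ) * ((s - r) / r) - g * s) := by
            rw [mul_assoc, ← Real.exp_add, ← sub_eq_add_neg]
        _ ≤ r ^ (n - 1) * Real.exp (-(g * r) + ε * g * r + -(ε * g) * s) := by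
            gcongr
            rw [hn1']
            have h3 : (n - 1 : ℝ) * ((s - r) / r) ≤ (1 - ε) * (g * r) * ((s - r) / r) :=
              mul_le_mul_of_nonneg_right hgr (div_nonneg (by linarith) hr.le)
            have h4 : (1 - ε) * (g * r) * ((s - r) / r) = (1 - ε) * (g * s - g * r) := by
              field_simp
            nlinarith
        _ = _ := by rw [Real.exp_add, Real.exp_add]; ring
    · simp [f, hsr]
  have hεg : 0 < ε * g := mul_pos hε hg
  have h5 : ∫⁻ s in Ioi r, ENNReal.ofReal (Real.exp (-(ε * g) * s)) =
      ENNReal.ofReal (Real.exp (-(ε * g) * r) / (ε * g)) := by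
    rw [← ofReal_integral_eq_lintegral_ofReal (integrableOn_exp_mul_Ioi (by linarith) _)
      (ae_of_all _ fun s => (Real.exp_pos _).le), integral_exp_mul_Ioi (by linarith)]
    congr 1
    field_simp
  rw [h1, lintegral_radial hf]
  calc (n : ℝ≥0∞) * volume (Metric.ball (0 : E n) 1) *
        ∫⁻ s in Ioi (0 : ℝ), ENNReal.ofReal (s ^ (n - 1)) * f s
      ≤ n * volume (Metric.ball (0 : E n) 1) * ∫⁻ s in Ioi (0 : ℝ),
        (Ici r).indicator (fun s => ENNReal.ofReal (r ^ (n - 1) * Real.exp (-(g * r)) *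
        Real.exp (ε * g * r)) * ENNReal.ofReal (Real.exp (-(ε * g) * s))) s := by
        gcongr 1
        exact setLIntegral_mono' measurableSet_Ioi h2
    _ = n * volume (Metric.ball (0 : E n) 1) *
        (ENNReal.ofReal (r ^ (n - 1) * Real.exp (-(g * r)) * Real.exp (ε * g * r)) *
          ENNReal.ofReal (Real.exp (-(ε * g) * r) / (ε * g))) := by
        rw [setLIntegral_indicator measurableSet_Ici,
          inter_eq_left.2 (Ici_subset_Ioi.2 hr),
          lintegral_const_mul _ (by fun_prop), setLIntegral_congr Ioi_ae_eq_Ici.symm, h5]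
    _ = _ := by
        have hb := ballVolume_pos n
        rw [volume_unitBall, ← ENNReal.ofReal_natCast, ← ENNReal.ofReal_mul (by positivity),
          ← ENNReal.ofReal_mul (by positivity), ← ENNReal.ofReal_mul (by positivity)]
        congr 1
        have e1 : r ^ n = r ^ (n - 1) * r := by rw [← pow_succ, hn1]
        have e2 : Real.exp (ε * g * r) * Real.exp (-(ε * g) * r) = 1 := by
          rw [← Real.exp_add]; simp
        rw [e1]
        calc (n : ℝ) * ballVolume n * (r ^ (n - 1) * Real.exp (-(g * r)) * Real.exp (ε * g * r) *
              (Real.exp (-(ε * g) * r) / (ε * g)))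
            = (n : ℝ) * ballVolume n * (r ^ (n - 1) * Real.exp (-(g * r)) *
              (Real.exp (ε * g * r) * Real.exp (-(ε * g) * r)) / (ε * g)) := by ring
          _ = _ := by rw [e2]; field_simp

end Radial

/-! ### Asymptotics of Gamma quotients -/

section Gamma

theorem Gamma_midpoint_sq_le {s t : ℝ} (hs : 0 < s) (ht : 0 < t) :
    Real.Gamma ((s + t) / 2) ^ 2 ≤ Real.Gamma s * Real.Gamma t := by
  have h := Real.Gamma_mul_add_mul_le_rpow_Gamma_mul_rpow_Gamma hs ht
    (a := 1 / 2) (b := 1 / 2) (by norm_num) (by norm_num) (by norm_num)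
  have hs' := Real.Gamma_pos_of_pos hs
  have ht' := Real.Gamma_pos_of_pos ht
  have e : 1 / 2 * s + 1 / 2 * t = (s + t) / 2 := by ring
  rw [e, ← Real.sqrt_eq_rpow, ← Real.sqrt_eq_rpow] at h
  calc Real.Gamma ((s + t) / 2) ^ 2 ≤ (√(Real.Gamma s) * √(Real.Gamma t)) ^ 2 := by
        have : 0 < Real.Gamma ((s + t) / 2) := Real.Gamma_pos_of_pos (by positivity)
        gcongr
    _ = _ := by rw [mul_pow, Real.sq_sqrt hs'.le, Real.sq_sqrt ht'.le]

/-- The quotient `Γ(n/2 + 1) / Γ((n + 1)/2)`, which is asymptotic to `√(n/2)`. -/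
noncomputable def gammaRatio (n : ℕ) : ℝ := Real.Gamma (n / 2 + 1) / Real.Gamma ((n + 1) / 2)

theorem gammaRatio_pos (n : ℕ) : 0 < gammaRatio n :=
  div_pos (Real.Gamma_pos_of_pos (by positivity)) (Real.Gamma_pos_of_pos (by positivity))

theorem gammaRatio_sq_le (n : ℕ) : gammaRatio n ^ 2 ≤ (n + 1) / 2 := by
  have hx : (0 : ℝ) < (n + 1) / 2 := by positivity
  have hΓ := Real.Gamma_pos_of_pos hx
  have h := Gamma_midpoint_sq_le hx (by linarith : (0 : ℝ) < (n + 1) / 2 + 1)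
  rw [Real.Gamma_add_one hx.ne'] at h
  have e : ((n + 1 : ℝ) / 2 + ((n + 1) / 2 + 1)) / 2 = n / 2 + 1 := by ring
  rw [e] at h
  rw [gammaRatio, div_pow, div_le_iff₀ (by positivity)]
  linarith

theorem le_gammaRatio_sq {n : ℕ} (hn : 1 ≤ n) : (n : ℝ) / 2 ≤ gammaRatio n ^ 2 := by
  have hn' : (0 : ℝ) < n := by exact_mod_cast hn
  have hx : (0 : ℝ) < n / 2 := by positivity
  have hΓ := Real.Gamma_pos_of_pos (by positivity : (0 : ℝ) < (n + 1) / 2)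
  have hΓ1 := Real.Gamma_pos_of_pos (by positivity : (0 : ℝ) < n / 2 + 1)
  have h := Gamma_midpoint_sq_le hx (by linarith : (0 : ℝ) < n / 2 + 1)
  have e : ((n : ℝ) / 2 + (n / 2 + 1)) / 2 = (n + 1) / 2 := by ring
  rw [e] at h
  have h2 := Real.Gamma_add_one hx.ne'
  rw [gammaRatio, div_pow, le_div_iff₀ (by positivity)]
  calc (n : ℝ) / 2 * Real.Gamma ((n + 1) / 2) ^ 2
      ≤ n / 2 * (Real.Gamma (n / 2) * Real.Gamma (n / 2 + 1)) := by gcongr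
    _ = (n / 2 * Real.Gamma (n / 2)) * Real.Gamma (n / 2 + 1) := by ring
    _ = _ := by rw [← h2, sq]

theorem tendsto_gammaRatio_sq : Tendsto (fun n : ℕ => gammaRatio n ^ 2 / n) atTop (𝓝 (1 / 2)) := by
  have h1 : Tendsto (fun n : ℕ => (1 : ℝ) / 2 + 1 / 2 * (1 / n)) atTop (𝓝 (1 / 2)) := by
    have := ((tendsto_one_div_atTop_nhds_zero_nat (𝕜 := ℝ)).const_mul (1 / 2)).const_add (1 / 2)
    rwa [mul_zero, add_zero] at this
  refine tendsto_of_tendsto_of_tendsto_of_le_of_le' tendsto_const_nhds h1 ?_ ?_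
  · filter_upwards [eventually_ge_atTop 1] with n hn
    have hn' : (0 : ℝ) < n := by exact_mod_cast hn
    rw [le_div_iff₀ hn']
    linarith [le_gammaRatio_sq hn]
  · filter_upwards [eventually_ge_atTop 1] with n hn
    have hn' : (0 : ℝ) < n := by exact_mod_cast hn
    rw [div_le_iff₀ hn']
    have : (1 / 2 + 1 / 2 * (1 / (n : ℝ))) * n = (n + 1) / 2 := by field_simp
    rw [this]
    exact gammaRatio_sq_le n

theorem tendsto_halfMean_mul_sqrt :
    Tendsto (fun n : ℕ => halfMean n * √(n : ℝ)) atTop (𝓝 (√(1 / 2) / √Real.pi)) := by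
  have h := (tendsto_gammaRatio_sq.sqrt).div_const (√Real.pi)
  refine h.congr' ?_
  filter_upwards [eventually_ge_atTop 1] with n hn
  have hn' : (0 : ℝ) < n := by exact_mod_cast hn
  have hπ := Real.pi_pos
  have hΓ := Real.Gamma_pos_of_pos (by positivity : (0 : ℝ) < (n + 1) / 2)
  rw [Real.sqrt_div (by positivity), Real.sqrt_sq (gammaRatio_pos n).le, halfMean, gammaRatio]
  have : (n : ℝ) = √n * √n := (Real.mul_self_sqrt hn'.le).symm
  field_simp
  rw [Real.sq_sqrt hn'.le]

theorem tendsto_log_div_nat : Tendsto (fun n : ℕ => Real.log n / n) atTop (𝓝 0) := by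
  have := Real.isLittleO_log_id_atTop.tendsto_div_nhds_zero
  exact this.comp tendsto_natCast_atTop_atTop

theorem tendsto_inv_nat : Tendsto (fun n : ℕ => 1 / (n : ℝ)) atTop (𝓝 0) :=
  tendsto_one_div_atTop_nhds_zero_nat

/-- A weak form of Stirling's formula. -/
theorem tendsto_log_factorial :
    Tendsto (fun n : ℕ => Real.log n.factorial / n - Real.log n) atTop (𝓝 (-1)) := by
  have h1 : Tendsto (fun n : ℕ => Real.log (Stirling.stirlingSeq n)) atTop
      (𝓝 (Real.log (√Real.pi))) :=
    Stirling.tendsto_stirlingSeq_sqrt_pi.log (by have := Real.pi_pos; positivity)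
  have h2 : Tendsto (fun n : ℕ => Real.log (Stirling.stirlingSeq n) * (1 / n) +
      (1 / 2 * Real.log 2 * (1 / n) + 1 / 2 * (Real.log n / n)) - 1) atTop (𝓝 (-1)) := by
    have := ((h1.mul tendsto_inv_nat).add ((tendsto_inv_nat.const_mul (1 / 2 * Real.log 2)).add
      (tendsto_log_div_nat.const_mul (1 / 2)))).sub_const 1
    simpa using this
  refine h2.congr' ?_
  filter_upwards [eventually_ge_atTop 1] with n hn
  have hn' : (0 : ℝ) < n := by exact_mod_cast hn
  rw [Stirling.log_stirlingSeq_formula, Real.log_mul two_ne_zero hn'.ne',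
    Real.log_div hn'.ne' (Real.exp_pos 1).ne', Real.log_exp]
  field_simp
  ring

theorem log_ballVolume {n : ℕ} (hn : 1 ≤ n) :
    Real.log (ballVolume n) = n / 2 * Real.log Real.pi -
      1 / 2 * (Real.log (gammaRatio n) + Real.log n.factorial - n * Real.log 2 +
        1 / 2 * Real.log Real.pi) := by
  have hn' : (0 : ℝ) < n := by exact_mod_cast hn
  have hπ := Real.pi_pos
  have hΓ := Real.Gamma_pos_of_pos (by positivity : (0 : ℝ) < (n + 1) / 2)
  have hΓ1 := Real.Gamma_pos_of_pos (by positivity : (0 : ℝ) < n / 2 + 1)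
  have hdup := Real.Gamma_mul_Gamma_add_half ((n + 1 : ℝ) / 2)
  have e1 : ((n + 1 : ℝ) / 2) + 1 / 2 = n / 2 + 1 := by ring
  have e2 : 2 * ((n + 1 : ℝ) / 2) = n + 1 := by ring
  have e3 : (1 : ℝ) - (n + 1) = -n := by ring
  rw [e1, e2, e3, Real.Gamma_nat_eq_factorial] at hdup
  have hsq : Real.Gamma (n / 2 + 1) ^ 2 =
      gammaRatio n * (n.factorial * 2 ^ (-(n : ℝ)) * √Real.pi) := by
    rw [← hdup, gammaRatio]
    field_simp
  have hlog := congrArg Real.log hsq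
  have hq := gammaRatio_pos n
  have hfac : (0 : ℝ) < n.factorial := by exact_mod_cast n.factorial_pos
  rw [Real.log_pow, Real.log_mul hq.ne' (by positivity), Real.log_mul (by positivity) (by positivity),
    Real.log_mul hfac.ne' (by positivity), Real.log_rpow two_pos, Real.log_sqrt hπ.le] at hlog
  rw [ballVolume, Real.log_div (by positivity) hΓ1.ne', Real.log_pow, Real.log_sqrt hπ.le]
  push_cast at hlog
  linarith

theorem tendsto_log_ballVolume :
    Tendsto (fun n : ℕ => Real.log (ballVolume n) / n + 1 / 2 * Real.log n) atTop
      (𝓝 (1 / 2 * Real.log (2 * Real.pi * Real.exp 1))) := by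
  have hπ := Real.pi_pos
  have hq : Tendsto (fun n : ℕ => Real.log (gammaRatio n ^ 2 / n) * (1 / n)) atTop (𝓝 0) := by
    simpa using (tendsto_gammaRatio_sq.log (by norm_num)).mul tendsto_inv_nat
  have h : Tendsto (fun n : ℕ => 1 / 2 * Real.log Real.pi + 1 / 2 * Real.log 2 -
      1 / 2 * (Real.log n.factorial / n - Real.log n) -
      1 / 4 * (Real.log (gammaRatio n ^ 2 / n) * (1 / n) + Real.log n / n) -
      1 / 4 * Real.log Real.pi * (1 / n)) atTop
      (𝓝 (1 / 2 * Real.log Real.pi + 1 / 2 * Real.log 2 - 1 / 2 * (-1) - 1 / 4 * (0 + 0) -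
        1 / 4 * Real.log Real.pi * 0)) :=
    (((tendsto_log_factorial.const_mul _).const_sub _).sub
      ((hq.add tendsto_log_div_nat).const_mul _)).sub (tendsto_inv_nat.const_mul _)
  have e : 1 / 2 * Real.log (2 * Real.pi * Real.exp 1) =
      1 / 2 * Real.log Real.pi + 1 / 2 * Real.log 2 - 1 / 2 * (-1) - 1 / 4 * (0 + 0) -
        1 / 4 * Real.log Real.pi * 0 := by
    rw [Real.log_mul (by positivity) (Real.exp_pos 1).ne', Real.log_mul two_ne_zero hπ.ne',
      Real.log_exp]
    ring
  rw [e]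
  refine h.congr' ?_
  filter_upwards [eventually_ge_atTop 1] with n hn
  have hn' : (0 : ℝ) < n := by exact_mod_cast hn
  rw [log_ballVolume hn, Real.log_div (pow_pos (gammaRatio_pos n) 2).ne' hn'.ne', Real.log_pow]
  push_cast
  field_simp
  ring

end Gamma

/-! ### Data points in the zero cell -/

section Model

variable {Ω : Type*} [MeasurableSpace Ω] {P : Measure Ω} {θ : E n → Ω → Ω}
  {N : Ω → Measure (E n)} {X : Ω → Measure (Hyperplane n)} {ℓ γ : ℝ}

/-- The probability that a Poisson process charges a set. -/
theorem IsPoissonProcess.measure_count_ne_zero {S : Type*} [MeasurableSpace S] {M : Ω → Measure S}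
    {Θ : Measure S} (h : IsPoissonProcess P M Θ) [IsProbabilityMeasure P] {A : Set S}
    (hA : MeasurableSet A) (hΘ : Θ A ≠ ∞) :
    P {ω | M ω A ≠ 0} = ENNReal.ofReal (1 - Real.exp (-(Θ A).toReal)) := by
  have h0 := h.measure_eq_natCast hA hΘ 0
  simp only [Nat.cast_zero, pow_zero, Nat.factorial_zero, Nat.cast_one, div_one, one_mul] at h0
  have hm : MeasurableSet {ω | M ω A = 0} := (h.measurable_count hA) (measurableSet_singleton 0)
  have : {ω | M ω A ≠ 0} = {ω | M ω A = 0}ᶜ := rfl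
  rw [this, prob_compl_eq_one_sub hm, h0, ENNReal.ofReal_sub _ (Real.exp_pos _).le,
    ENNReal.ofReal_one]

theorem IsPoissonProcess.measure_count_ne_zero_le {S : Type*} [MeasurableSpace S]
    {M : Ω → Measure S} {Θ : Measure S} (h : IsPoissonProcess P M Θ) [IsProbabilityMeasure P]
    {A : Set S} (hA : MeasurableSet A) : P {ω | M ω A ≠ 0} ≤ Θ A := by
  by_cases hΘ : Θ A = ∞
  · rw [hΘ]; exact le_top
  · rw [h.measure_count_ne_zero hA hΘ]
    refine ENNReal.ofReal_le_of_le_toReal ?_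
    linarith [Real.add_one_le_exp (-(Θ A).toReal)]

/-- The part in `S` of the zero cell, without the origin. -/
def cellPart (X : Ω → Measure (Hyperplane n)) (S : Set (E n)) (ω : Ω) : Set (E n) :=
  (zeroCell (X ω) ∩ S) \ {0}

theorem cellPart_eq (h : IsCompressionModel P θ N X ℓ γ) (S : Set (E n)) (ω : Ω) :
    cellPart X S ω = Prod.mk ((0 : E n), X ω) ⁻¹' cellGraph (S \ {0}) := by
  have hc := h.hyperplane_poisson.counting
  have h0 : X ω = (X ω).map (Hyperplane.shift 0) := by
    rw [← h.hyperplane_compatible, h.framework.zero]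
  ext y
  rw [mem_preimage, mem_cellGraph_iff (hc ω) (h.hyperplane_locallyFinite ω) (h0 ▸ hc ω), ← h0,
    sub_zero, cellPart, inter_sdiff_assoc]

theorem measurableSet_cellPart_graph (h : IsCompressionModel P θ N X ℓ γ) {S : Set (E n)}
    (hS : MeasurableSet S) : MeasurableSet {p : Ω × E n | p.2 ∈ cellPart X S p.1} := by
  have h1 := measurableSet_cellGraph (hS.diff (measurableSet_singleton (0 : E n)))
  have hm : Measurable fun p : Ω × E n => (((0 : E n), X p.1), p.2) :=
    ((measurable_const.prodMk (h.hyperplane_poisson.measurable.comp measurable_fst)).prodMk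
      measurable_snd)
  refine (h1.preimage hm).congr ?_
  ext p
  rw [mem_ofPred_eq, cellPart_eq h]
  rfl

theorem measurableSet_cellPart {Ω' : Type*} {X : Ω' → Measure (Hyperplane n)} {S : Set (E n)}
    (hS : MeasurableSet S) (ω : Ω') :
    MeasurableSet (cellPart X S ω) :=
  (isClosed_closure.measurableSet.inter hS).diff (measurableSet_singleton 0)

/-- Conditioning on the hyperplanes: the data are Poisson in the zero cell. -/
theorem measure_otherDataEvent (h : IsCompressionModel P θ N X ℓ γ) {S : Set (E n)}
    (hS : MeasurableSet S) :
    P (otherDataEvent N X S) = ∫⁻ ω, P {ω' | N ω' (cellPart X S ω) ≠ 0} ∂P := by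
  have := h.framework.isProbabilityMeasure
  have hXm := h.hyperplane_poisson.measurable
  have hNm := h.data_poisson.measurable
  let A : Set (Measure (Hyperplane n) × Measure (E n)) :=
    {p | (((0 : E n), p.1), p.2) ∈ chargeSet (cellGraph (S \ {0}))}
  have hA : MeasurableSet A := (measurableSet_chargeSet (measurableSet_cellGraph
    (hS.diff (measurableSet_singleton 0)))).preimage (by fun_prop)
  have hmem : ∀ ω ω', (X ω, N ω') ∈ A ↔ N ω' (cellPart X S ω) ≠ 0 := by
    intro ω ω'
    simp only [A, mem_ofPred_eq]
    rw [mem_chargeSet_iff (h.data_locallyFinite ω'), cellPart_eq h]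
  have hmap := (indepFun_iff_map_prod_eq_prod_map_map hXm.aemeasurable hNm.aemeasurable).1
    h.indep.symm
  have := Measure.isProbabilityMeasure_map (μ := P) hXm.aemeasurable
  have := Measure.isProbabilityMeasure_map (μ := P) hNm.aemeasurable
  have h1 : otherDataEvent N X S = (fun ω => (X ω, N ω)) ⁻¹' A := by
    ext ω
    exact (hmem ω ω).symm
  rw [h1, ← Measure.map_apply (hXm.prodMk hNm) hA, hmap, Measure.prod_apply hA,
    lintegral_map (measurable_measure_prodMk_left hA) hXm]
  refine lintegral_congr fun ω => ?_
  rw [Measure.map_apply hNm (measurable_prodMk_left hA)]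
  congr 1
  ext ω'
  exact hmem ω ω'

/-- The exponential decay rate `2 γ m_n` of the probability that a point belongs to the zero
cell. -/
noncomputable def cellRate (n : ℕ) (γ : ℝ) : ℝ := 2 * γ * halfMean n

theorem measure_mem_cellPart_le [NeZero n] (h : IsCompressionModel P θ N X ℓ γ) (hγ : 0 < γ)
    (S : Set (E n)) (y : E n) :
    P {ω | y ∈ cellPart X S ω} ≤ ENNReal.ofReal (Real.exp (-(cellRate n γ * ‖y‖))) := by
  have hk : ∀ k, P {ω | y ∈ cellPart X S ω} ≤
      ENNReal.ofReal (Real.exp (-(cellRate n γ * (shrink k * ‖y‖)))) := by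
    intro k
    have hm : MeasurableSet (Hyperplane.hit (segment ℝ 0 (shrink k • y))) :=
      Hyperplane.measurableSet_hit (isCompact_segment _ _)
    have hI := hyperplaneIntensity_hit_segment hγ (shrink k • y)
    have hpos : 0 ≤ 2 * γ * halfMean n * ‖shrink k • y‖ := by
      have := halfMean_pos (n := n)
      positivity
    have h0 := h.hyperplane_poisson.measure_eq_natCast hm (by rw [hI]; exact ENNReal.ofReal_ne_top) 0
    simp only [Nat.cast_zero, pow_zero, Nat.factorial_zero, Nat.cast_one, div_one, one_mul] at h0
    rw [hI, ENNReal.toReal_ofReal hpos, norm_smul, Real.norm_of_nonneg (shrink_nonneg k)] at h0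
    rw [cellRate, ← h0]
    refine measure_mono fun ω hω => ?_
    exact (mem_zeroCell_iff (h.hyperplane_poisson.counting ω)).1 hω.1.1 k
  refine ge_of_tendsto (x := atTop) ?_ (Eventually.of_forall hk)
  refine ENNReal.tendsto_ofReal ((Real.continuous_exp.tendsto _).comp ?_)
  have := ((tendsto_shrink.mul_const ‖y‖).const_mul (cellRate n γ)).neg
  rwa [one_mul] at this

theorem le_measure_mem_cellPart [NeZero n] (h : IsCompressionModel P θ N X ℓ γ) (hγ : 0 < γ)
    {S : Set (E n)} {y : E n} (hy : y ∈ S) (hy0 : y ≠ 0) :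
    ENNReal.ofReal (Real.exp (-(cellRate n γ * ‖y‖))) ≤ P {ω | y ∈ cellPart X S ω} := by
  have hm : MeasurableSet (Hyperplane.hit (segment ℝ 0 y)) :=
    Hyperplane.measurableSet_hit (isCompact_segment _ _)
  have hI := hyperplaneIntensity_hit_segment hγ y
  have hpos : 0 ≤ 2 * γ * halfMean n * ‖y‖ := by
    have := halfMean_pos (n := n)
    positivity
  have h0 := h.hyperplane_poisson.measure_eq_natCast hm (by rw [hI]; exact ENNReal.ofReal_ne_top) 0
  simp only [Nat.cast_zero, pow_zero, Nat.factorial_zero, Nat.cast_one, div_one, one_mul] at h0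
  rw [hI, ENNReal.toReal_ofReal hpos] at h0
  rw [cellRate, ← h0]
  refine measure_mono fun ω hω => ⟨⟨?_, hy⟩, hy0⟩
  rw [mem_zeroCell_iff (h.hyperplane_poisson.counting ω)]
  intro k
  refine measure_mono_null (Hyperplane.hit_mono ?_) hω
  refine (convex_segment (0 : E n) y).segment_subset (left_mem_segment ℝ 0 y) ?_
  rw [segment_eq_image]
  exact ⟨shrink k, ⟨shrink_nonneg k, (shrink_lt_one k).le⟩, by simp⟩

theorem lintegral_volume_cellPart (h : IsCompressionModel P θ N X ℓ γ) {S : Set (E n)}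
    (hS : MeasurableSet S) :
    ∫⁻ ω, volume (cellPart X S ω) ∂P = ∫⁻ y in S, P {ω | y ∈ cellPart X S ω} := by
  have := h.framework.isProbabilityMeasure
  have hm := measurableSet_cellPart_graph h hS
  have h1 := Measure.prod_apply (μ := P) (ν := (volume : Measure (E n))) hm
  rw [Measure.prod_apply_symm hm] at h1
  have h2 : ∫⁻ y in S, P {ω | y ∈ cellPart X S ω} = ∫⁻ y, P {ω | y ∈ cellPart X S ω} := by
    rw [← lintegral_indicator hS]
    refine lintegral_congr fun y => ?_
    by_cases hy : y ∈ S
    · rw [indicator_of_mem hy]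
    · rw [indicator_of_notMem hy]
      have : {ω | y ∈ cellPart X S ω} = ∅ := by
        ext ω
        simp [cellPart, hy]
      rw [this, measure_empty]
  rw [h2]
  exact h1.symm

theorem measurable_volume_cellPart (h : IsCompressionModel P θ N X ℓ γ) {S : Set (E n)}
    (hS : MeasurableSet S) : Measurable fun ω => volume (cellPart X S ω) :=
  measurable_measure_prodMk_left (measurableSet_cellPart_graph h hS)

/-- **First moment bound**: the probability that a part of the zero cell contains data is at most
the mean number of data points in it. -/
theorem measure_otherDataEvent_le [NeZero n] (h : IsCompressionModel P θ N X ℓ γ) (hγ : 0 < γ)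
    {S : Set (E n)} (hS : MeasurableSet S) :
    P (otherDataEvent N X S) ≤
      ENNReal.ofReal ℓ * ∫⁻ y in S, ENNReal.ofReal (Real.exp (-(cellRate n γ * ‖y‖))) := by
  have := h.framework.isProbabilityMeasure
  calc P (otherDataEvent N X S) = ∫⁻ ω, P {ω' | N ω' (cellPart X S ω) ≠ 0} ∂P :=
        measure_otherDataEvent h hS
    _ ≤ ∫⁻ ω, ENNReal.ofReal ℓ * volume (cellPart X S ω) ∂P :=
        lintegral_mono fun ω =>
          h.data_poisson.measure_count_ne_zero_le (measurableSet_cellPart hS ω)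
    _ = ENNReal.ofReal ℓ * ∫⁻ y in S, P {ω | y ∈ cellPart X S ω} := by
        rw [lintegral_const_mul _ (measurable_volume_cellPart h hS), lintegral_volume_cellPart h hS]
    _ ≤ _ := by
        gcongr with y
        exact measure_mem_cellPart_le h hγ S y

/-- The second moment of the volume of the part in `S` of the zero cell. Since
`P(y, z ∈ Z) ≤ √(P(y ∈ Z) P(z ∈ Z))`, it is at most the square of the integral of
`√(P(y ∈ Z))`. -/
theorem lintegral_volume_cellPart_sq_le [NeZero n] (h : IsCompressionModel P θ N X ℓ γ)
    (hγ : 0 < γ) {S : Set (E n)} (hS : MeasurableSet S) :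
    ∫⁻ ω, volume (cellPart X S ω) ^ 2 ∂P ≤
      (∫⁻ y in S, ENNReal.ofReal (Real.exp (-(cellRate n γ / 2 * ‖y‖)))) ^ 2 := by
  have := h.framework.isProbabilityMeasure
  have hm := measurableSet_cellPart_graph h hS
  have hm2 : MeasurableSet {p : Ω × (E n × E n) |
      p.2 ∈ cellPart X S p.1 ×ˢ cellPart X S p.1} :=
    (hm.preimage (f := fun p : Ω × (E n × E n) => (p.1, p.2.1)) (by fun_prop)).inter
      (hm.preimage (f := fun p : Ω × (E n × E n) => (p.1, p.2.2)) (by fun_prop))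
  have hsq : ∀ ω, volume (cellPart X S ω) ^ 2 =
      ((volume : Measure (E n)).prod volume) (cellPart X S ω ×ˢ cellPart X S ω) := by
    intro ω
    rw [Measure.prod_prod, sq]
  have h1 := Measure.prod_apply (μ := P) (ν := (volume : Measure (E n)).prod volume) hm2
  rw [Measure.prod_apply_symm hm2] at h1
  have h2 : ∫⁻ ω, volume (cellPart X S ω) ^ 2 ∂P =
      ∫⁻ p : E n × E n, P {ω | p ∈ cellPart X S ω ×ˢ cellPart X S ω} ∂(volume.prod volume) := by
    simp_rw [hsq]
    exact h1.symm
  set f : E n → ℝ≥0∞ := S.indicator fun y => ENNReal.ofReal (Real.exp (-(cellRate n γ / 2 * ‖y‖)))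
    with hf
  have hfm : Measurable f := Measurable.indicator (by fun_prop) hS
  have hle : ∀ p : E n × E n, P {ω | p ∈ cellPart X S ω ×ˢ cellPart X S ω} ≤ f p.1 * f p.2 := by
    rintro ⟨y, z⟩
    by_cases hyz : y ∈ S ∧ z ∈ S
    · simp only [hf, indicator_of_mem hyz.1, indicator_of_mem hyz.2]
      rw [← ENNReal.ofReal_mul (Real.exp_pos _).le, ← Real.exp_add]
      have hg : 0 < cellRate n γ := by
        have := halfMean_pos (n := n)
        unfold cellRate
        positivity
      -- The minimum of two probabilities is at most their geometric mean.
      rcases le_total ‖y‖ ‖z‖ with hle | hle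
      · refine (measure_mono fun ω hω => hω.2).trans ((measure_mem_cellPart_le h hγ S z).trans ?_)
        refine ENNReal.ofReal_le_ofReal (Real.exp_le_exp.2 ?_)
        nlinarith
      · refine (measure_mono fun ω hω => hω.1).trans ((measure_mem_cellPart_le h hγ S y).trans ?_)
        refine ENNReal.ofReal_le_ofReal (Real.exp_le_exp.2 ?_)
        nlinarith
    · have : {ω | (y, z) ∈ cellPart X S ω ×ˢ cellPart X S ω} = ∅ := by
        ext ω
        simp only [cellPart, mem_prod, Set.mem_sdiff, mem_inter_iff, mem_ofPred_eq, mem_empty_iff_false,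
          iff_false]
        tauto
      rw [this, measure_empty]
      exact zero_le
  rw [h2, ← lintegral_indicator hS, sq, ← lintegral_prod_mul hfm.aemeasurable hfm.aemeasurable]
  exact lintegral_mono hle

/-- An elementary lower bound for `1 - exp (-u)`, linear in the first two moments of `u`. -/
theorem one_sub_exp_neg_add_ge {u c : ℝ} (hu : 0 ≤ u) :
    2 * c * u ≤ 1 - Real.exp (-u) + c ^ 2 * (u + u ^ 2) := by
  have h1 : u / (1 + u) ≤ 1 - Real.exp (-u) := by
    have h2 : Real.exp (-u) ≤ 1 / (1 + u) := by
      rw [Real.exp_neg, ← one_div]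
      exact one_div_le_one_div_of_le (by linarith) (by linarith [Real.add_one_le_exp u])
    have h3 : u / (1 + u) = 1 - 1 / (1 + u) := by field_simp; ring
    linarith
  have h4 : 2 * c * u ≤ u / (1 + u) + c ^ 2 * (u + u ^ 2) := by
    have h5 : u / (1 + u) + c ^ 2 * (u + u ^ 2) - 2 * c * u =
        u / (1 + u) * (1 - c * (1 + u)) ^ 2 := by
      field_simp; ring
    have : 0 ≤ u / (1 + u) * (1 - c * (1 + u)) ^ 2 := by positivity
    linarith
  linarith

/-- Rescaling: halving the rate on a ball costs at most the factor `2 ^ n`. -/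
theorem lintegral_half_rate_le {g r : ℝ} (hr : 0 < r) :
    ∫⁻ y in Metric.closedBall (0 : E n) r, ENNReal.ofReal (Real.exp (-(g / 2 * ‖y‖))) ≤
      2 ^ n * ∫⁻ y in Metric.closedBall (0 : E n) r, ENNReal.ofReal (Real.exp (-(g * ‖y‖))) := by
  set f : E n → ℝ≥0∞ := (Metric.closedBall (0 : E n) r).indicator
    fun y => ENNReal.ofReal (Real.exp (-(g / 2 * ‖y‖))) with hf
  have hfm : Measurable f := Measurable.indicator (by fun_prop) measurableSet_closedBall
  have h : ∫⁻ y, f ((2 : ℝ) • y) = ENNReal.ofReal |((2 : ℝ) ^ n)⁻¹| * ∫⁻ y, f y := by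
    rw [← lintegral_map hfm (measurable_const_smul (2 : ℝ)),
      Measure.map_addHaar_smul _ two_ne_zero, lintegral_smul_measure, finrank_euclideanSpace_fin,
      smul_eq_mul]
  have hle : ∫⁻ y, f ((2 : ℝ) • y) ≤
      ∫⁻ y in Metric.closedBall (0 : E n) r, ENNReal.ofReal (Real.exp (-(g * ‖y‖))) := by
    rw [← lintegral_indicator measurableSet_closedBall]
    refine lintegral_mono fun y => ?_
    by_cases hy : (2 : ℝ) • y ∈ Metric.closedBall (0 : E n) r
    · have hy' : y ∈ Metric.closedBall (0 : E n) r := by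
        rw [mem_closedBall_zero_iff, norm_smul, Real.norm_ofNat] at hy
        rw [mem_closedBall_zero_iff]
        linarith [norm_nonneg y]
      simp only [hf]
      rw [indicator_of_mem hy, indicator_of_mem hy', norm_smul, Real.norm_ofNat]
      refine ENNReal.ofReal_le_ofReal (Real.exp_le_exp.2 (le_of_eq ?_))
      ring
    · simp only [hf]
      rw [indicator_of_notMem hy]
      exact zero_le
  rw [← lintegral_indicator measurableSet_closedBall]
  have h2 : ∫⁻ y, f y = 2 ^ n * ∫⁻ y, f ((2 : ℝ) • y) := by
    have e : ENNReal.ofReal |((2 : ℝ) ^ n)⁻¹| = (2 ^ n)⁻¹ := by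
      rw [abs_of_nonneg (by positivity), ENNReal.ofReal_inv_of_pos (by positivity),
        ENNReal.ofReal_pow (by norm_num), ENNReal.ofReal_ofNat]
    rw [h, e, ← mul_assoc, ENNReal.mul_inv_cancel (by positivity) (by simp), one_mul]
  rw [h2]
  gcongr

/-- **Second moment bound**: if the mean number of data points in a ball that belong to the zero
cell is at least one, then the zero cell contains data with probability at least `4⁻ⁿ / 2`. -/
theorem le_measure_otherDataEvent [NeZero n] (h : IsCompressionModel P θ N X ℓ γ) (hℓ : 0 < ℓ)
    (hγ : 0 < γ) {r : ℝ} (hr : 0 < r)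
    (hmean : 1 ≤ ℓ * (ballVolume n * r ^ n * Real.exp (-(cellRate n γ * r)))) :
    ENNReal.ofReal (1 / (2 * 4 ^ n)) ≤ P (otherDataEvent N X univ) := by
  have := h.framework.isProbabilityMeasure
  set B : Set (E n) := Metric.closedBall 0 r with hB
  have hBm : MeasurableSet B := measurableSet_closedBall
  have hBfin : volume B ≠ ∞ := (isCompact_closedBall _ _).measure_lt_top.ne
  set g := cellRate n γ with hg
  have hgpos : 0 < g := by
    have := halfMean_pos (n := n)
    rw [hg, cellRate]
    positivity
  set V : Ω → ℝ := fun ω => (volume (cellPart X B ω)).toReal with hV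
  have hVfin : ∀ ω, volume (cellPart X B ω) ≠ ∞ := fun ω =>
    measure_ne_top_of_subset (fun y hy => hy.1.2) hBfin
  have hVm : Measurable V := (measurable_volume_cellPart h hBm).ennreal_toReal
  have hV0 : ∀ ω, 0 ≤ V ω := fun ω => ENNReal.toReal_nonneg
  have hVof : ∀ ω, ENNReal.ofReal (V ω) = volume (cellPart X B ω) := fun ω =>
    ENNReal.ofReal_toReal (hVfin ω)
  set I : ℝ≥0∞ := ∫⁻ y in B, ENNReal.ofReal (Real.exp (-(g * ‖y‖))) with hI
  have hIfin : I ≠ ∞ := by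
    refine ne_top_of_le_ne_top hBfin ?_
    calc I ≤ ∫⁻ _ in B, 1 := by
          refine lintegral_mono fun y => ?_
          rw [← ENNReal.ofReal_one]
          refine ENNReal.ofReal_le_ofReal (Real.exp_le_one_iff.2 ?_)
          have := mul_nonneg hgpos.le (norm_nonneg y)
          linarith
      _ = volume B := by simp
  -- The first moment of the volume.
  have hEV : ∫⁻ ω, ENNReal.ofReal (V ω) ∂P = I := by
    simp_rw [hVof]
    rw [lintegral_volume_cellPart h hBm]
    have hne : ∀ᵐ y ∂(volume.restrict B), y ≠ (0 : E n) :=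
      ae_restrict_of_ae (by simp [ae_iff])
    refine lintegral_congr_ae ?_
    filter_upwards [hne, ae_restrict_mem hBm] with y hy hyB
    exact le_antisymm (measure_mem_cellPart_le h hγ B y) (le_measure_mem_cellPart h hγ hyB hy)
  have hEV2 : ∫⁻ ω, ENNReal.ofReal (V ω ^ 2) ∂P ≤ 4 ^ n * I ^ 2 := by
    have e : ∀ ω, ENNReal.ofReal (V ω ^ 2) = volume (cellPart X B ω) ^ 2 := fun ω => by
      rw [ENNReal.ofReal_pow (hV0 ω), hVof]
    simp_rw [e]
    refine (lintegral_volume_cellPart_sq_le h hγ hBm).trans ?_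
    calc (∫⁻ y in B, ENNReal.ofReal (Real.exp (-(cellRate n γ / 2 * ‖y‖)))) ^ 2
        ≤ (2 ^ n * I) ^ 2 := by
          gcongr
          exact lintegral_half_rate_le hr
      _ = 4 ^ n * I ^ 2 := by
          rw [mul_pow, ← pow_mul, mul_comm n 2, pow_mul]
          norm_num
  set a : ℝ := ℓ * I.toReal with ha
  have ha1 : 1 ≤ a := by
    refine hmean.trans (mul_le_mul_of_nonneg_left ?_ hℓ.le)
    rw [← ENNReal.ofReal_le_iff_le_toReal hIfin, ENNReal.ofReal_mul
      (mul_pos (ballVolume_pos n) (pow_pos hr n)).le, ← volume_closedBall_eq hr.le, mul_comm,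
      ← setLIntegral_const]
    refine setLIntegral_mono' hBm fun y hy => ?_
    refine ENNReal.ofReal_le_ofReal (Real.exp_le_exp.2 ?_)
    have := mul_le_mul_of_nonneg_left (mem_closedBall_zero_iff.1 hy) hgpos.le
    linarith
  set c : ℝ := 1 / (1 + 4 ^ n * a) with hc
  have hc0 : 0 < c := by positivity
  -- The probability in terms of the volume, and the elementary inequality integrated.
  set p : ℝ≥0∞ := P (otherDataEvent N X B) with hp
  have hpe : p = ∫⁻ ω, ENNReal.ofReal (1 - Real.exp (-(ℓ * V ω))) ∂P := by
    rw [hp, measure_otherDataEvent h hBm]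
    refine lintegral_congr fun ω => ?_
    have e : (ENNReal.ofReal ℓ • (volume : Measure (E n))) (cellPart X B ω) =
        ENNReal.ofReal ℓ * volume (cellPart X B ω) := rfl
    rw [h.data_poisson.measure_count_ne_zero (measurableSet_cellPart hBm ω)
      (by rw [e]; exact ENNReal.mul_ne_top ENNReal.ofReal_ne_top (hVfin ω)), e,
      ENNReal.toReal_mul, ENNReal.toReal_ofReal hℓ.le]
  have hpt : ∀ ω, ENNReal.ofReal (2 * c * ℓ) * ENNReal.ofReal (V ω) ≤
      ENNReal.ofReal (1 - Real.exp (-(ℓ * V ω))) + (ENNReal.ofReal (c ^ 2 * ℓ) *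
        ENNReal.ofReal (V ω) + ENNReal.ofReal (c ^ 2 * ℓ ^ 2) * ENNReal.ofReal (V ω ^ 2)) := by
    intro ω
    have hu : 0 ≤ ℓ * V ω := mul_nonneg hℓ.le (hV0 ω)
    have hexp : Real.exp (-(ℓ * V ω)) ≤ 1 := Real.exp_le_one_iff.2 (by linarith)
    have := hV0 ω
    rw [← ENNReal.ofReal_mul (by positivity), ← ENNReal.ofReal_mul (by positivity),
      ← ENNReal.ofReal_mul (by positivity), ← ENNReal.ofReal_add (by positivity) (by positivity),
      ← ENNReal.ofReal_add (by linarith) (by positivity)]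
    refine ENNReal.ofReal_le_ofReal ?_
    have := one_sub_exp_neg_add_ge (c := c) hu
    nlinarith
  have hint : ENNReal.ofReal (2 * c * ℓ) * I ≤ p + (ENNReal.ofReal (c ^ 2 * ℓ) * I +
      ENNReal.ofReal (c ^ 2 * ℓ ^ 2) * (4 ^ n * I ^ 2)) := by
    have h1 := lintegral_mono (μ := P) hpt
    rw [lintegral_const_mul _ (by fun_prop), lintegral_add_left (by fun_prop), ← hpe,
      lintegral_add_left (by fun_prop), lintegral_const_mul _ (by fun_prop),
      lintegral_const_mul _ (by fun_prop), hEV] at h1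
    refine h1.trans ?_
    gcongr
  have hpfin : p ≠ ∞ := measure_ne_top _ _
  have hIof : I = ENNReal.ofReal I.toReal := (ENNReal.ofReal_toReal hIfin).symm
  have hreal : 2 * c * a ≤ p.toReal + c ^ 2 * (a + 4 ^ n * a ^ 2) := by
    have hI0 : 0 ≤ I.toReal := ENNReal.toReal_nonneg
    have e4 : (4 : ℝ≥0∞) ^ n = ENNReal.ofReal (4 ^ n) := by
      rw [ENNReal.ofReal_pow (by norm_num), ENNReal.ofReal_ofNat]
    rw [← ENNReal.ofReal_toReal hpfin, hIof, e4, ← ENNReal.ofReal_pow hI0,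
      ← ENNReal.ofReal_mul (by positivity), ← ENNReal.ofReal_mul (by positivity),
      ← ENNReal.ofReal_mul (by positivity), ← ENNReal.ofReal_mul (by positivity),
      ← ENNReal.ofReal_add (by positivity) (by positivity),
      ← ENNReal.ofReal_add ENNReal.toReal_nonneg (by positivity),
      ENNReal.ofReal_le_ofReal_iff (by positivity)] at hint
    rw [ha]
    nlinarith
  have hca : c * (1 + 4 ^ n * a) = 1 := by
    rw [hc]; field_simp
  have hfinal : 1 / (2 * 4 ^ n) ≤ p.toReal := by
    have h1 : c * a ≤ p.toReal := by
      have : c ^ 2 * (a + 4 ^ n * a ^ 2) = c * a * (c * (1 + 4 ^ n * a)) := by ring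
      rw [this, hca] at hreal
      linarith
    refine le_trans ?_ h1
    have h4 : (1 : ℝ) ≤ 4 ^ n := one_le_pow₀ (by norm_num)
    rw [hc, div_mul_eq_mul_div, one_mul, div_le_div_iff₀ (by positivity) (by positivity)]
    nlinarith
  calc ENNReal.ofReal (1 / (2 * 4 ^ n)) ≤ p := ENNReal.ofReal_le_of_le_toReal hfinal
    _ ≤ P (otherDataEvent N X univ) := by
        refine measure_mono fun ω hω h0 => hω (measure_mono_null ?_ h0)
        exact sdiff_subset_sdiff_left (inter_subset_inter_right _ (subset_univ _))

end Model

/-! ### Conditional probabilities in a fixed dimension -/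

section Model

variable {Ω : Type*} [MeasurableSpace Ω] {P : Measure Ω} {θ : E n → Ω → Ω}
  {N : Ω → Measure (E n)} {X : Ω → Measure (Hyperplane n)} {ℓ γ : ℝ}

theorem otherDataInZeroCell_eq {Ω' : Type*} {N : Ω' → Measure (E n)}
    {X : Ω' → Measure (Hyperplane n)} :
     otherDataInZeroCell N X = otherDataEvent N X univ := by
  ext ω
  simp [otherDataInZeroCell, otherDataEvent, pos_iff_ne_zero]

theorem otherDataEvent_iff (h : IsCompressionModel P θ N X ℓ γ) {S : Set (E n)}
    (hS : MeasurableSet S) (ω : Ω) :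
    ω ∈ otherDataEvent N X S ↔ ∃ x ∈ points (N ω), x ∈ zeroCell (X ω) ∧ x ∈ S ∧ x ≠ 0 := by
  have hm : MeasurableSet ((zeroCell (X ω) ∩ S) \ {(0 : E n)}) :=
    measurableSet_cellPart (X := X) hS ω
  rw [otherDataEvent, mem_ofPred_eq, ne_eq, (h.data_poisson.counting ω).eq_zero_iff hm]
  push Not
  refine exists_congr fun x => and_congr_right fun _ => ?_
  rw [Set.mem_sdiff, mem_inter_iff, mem_singleton_iff, and_assoc]

theorem mem_otherDataEvent_of_le_farthest (h : IsCompressionModel P θ N X ℓ γ) {r : ℝ}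
    (hr : 0 < r) {ω : Ω} (hω : ENNReal.ofReal r ≤ farthest (N ω) (X ω)) :
    ω ∈ otherDataEvent N X (Metric.ball 0 r)ᶜ := by
  rw [otherDataEvent_iff h measurableSet_ball.compl]
  by_contra! hcon
  -- All data points of the cell lie in the open ball, so there are only finitely many of them.
  have hlt : ∀ x ∈ points (N ω) ∩ zeroCell (X ω), ‖x‖ < r := by
    intro x hx
    by_contra! hge
    refine absurd (hcon x hx.1 hx.2 (by simpa using hge)) ?_
    rintro rfl
    rw [norm_zero] at hge
    exact absurd hge hr.not_ge
  have hfin : (points (N ω) ∩ zeroCell (X ω)).Finite :=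
    ((h.data_poisson.counting ω).finite_points measurableSet_closedBall
      (h.data_locallyFinite ω _ (isCompact_closedBall (0 : E n) r))).subset fun x hx =>
        ⟨hx.1, by simpa using (hlt x hx).le⟩
  refine absurd hω (not_le.2 ?_)
  rw [farthest, ← hfin.coe_toFinset]
  simp only [Finset.mem_coe]
  rw [← Finset.sup_eq_iSup]
  refine (Finset.sup_lt_iff (by simpa using hr)).2 fun x hx => ?_
  exact (ENNReal.ofReal_lt_ofReal_iff hr).2 (hlt x (hfin.mem_toFinset.1 hx))

theorem mem_otherDataEvent_of_farthest_le (h : IsCompressionModel P θ N X ℓ γ) {r : ℝ}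
    (hr : 0 < r) {ω : Ω} (hω : farthest (N ω) (X ω) ≤ ENNReal.ofReal r)
    (hC : ω ∈ otherDataEvent N X univ) : ω ∈ otherDataEvent N X (Metric.closedBall 0 r) := by
  rw [otherDataEvent_iff h MeasurableSet.univ] at hC
  rw [otherDataEvent_iff h measurableSet_closedBall]
  obtain ⟨x, hx, hxZ, -, hx0⟩ := hC
  refine ⟨x, hx, hxZ, ?_, hx0⟩
  have h1 : ENNReal.ofReal ‖x‖ ≤ farthest (N ω) (X ω) :=
    le_iSup₂ (f := fun x (_ : x ∈ points (N ω) ∩ zeroCell (X ω)) => ENNReal.ofReal ‖x‖) x ⟨hx, hxZ⟩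
  simpa using (ENNReal.ofReal_le_ofReal_iff hr.le).1 (h1.trans hω)

/-- The order of magnitude of the mean number of data points of the zero cell near distance `r`
from the origin. -/
noncomputable def meanScale (n : ℕ) (ℓ γ r : ℝ) : ℝ :=
  ℓ * (ballVolume n * r ^ n * Real.exp (-(cellRate n γ * r)))

theorem meanScale_pos {r : ℝ} (hℓ : 0 < ℓ) (hr : 0 < r) : 0 < meanScale n ℓ γ r := by
  have := ballVolume_pos n
  unfold meanScale
  positivity

/-- A conditional Palm probability is at most a first moment divided by the second moment bound. -/
theorem palm_cond_le [NeZero n] (h : IsCompressionModel P θ N X ℓ γ) (hℓ : 0 < ℓ) (hγ : 0 < γ)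
    {s : ℝ} (hs : 0 < s) (hmean : 1 ≤ meanScale n ℓ γ s) {A : Set Ω} {S : Set (E n)}
    (hS : MeasurableSet S) (hA : otherDataInZeroCell N X ∩ A ⊆ otherDataEvent N X S) {b : ℝ}
    (hb : ∫⁻ y in S, ENNReal.ofReal (Real.exp (-(cellRate n γ * ‖y‖))) ≤ ENNReal.ofReal b) :
    (palm P θ N ℓ)[A | otherDataInZeroCell N X] ≤ ENNReal.ofReal (2 * 4 ^ n * (ℓ * b)) := by
  have hC : MeasurableSet (otherDataInZeroCell N X) := by
    rw [otherDataInZeroCell_eq]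
    exact measurableSet_otherDataEvent h MeasurableSet.univ
  have h1 : (palm P θ N ℓ (otherDataInZeroCell N X))⁻¹ ≤ ENNReal.ofReal (2 * 4 ^ n) := by
    rw [otherDataInZeroCell_eq, palm_otherDataEvent h hℓ MeasurableSet.univ,
      ENNReal.inv_le_iff_inv_le, ← ENNReal.ofReal_inv_of_pos (by positivity), ← one_div]
    exact le_measure_otherDataEvent h hℓ hγ hs hmean
  have h2 : palm P θ N ℓ (otherDataInZeroCell N X ∩ A) ≤ ENNReal.ofReal (ℓ * b) := by
    refine (measure_mono hA).trans ?_
    rw [palm_otherDataEvent h hℓ hS, ENNReal.ofReal_mul hℓ.le]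
    exact (measure_otherDataEvent_le h hγ hS).trans (by gcongr)
  rw [cond_apply hC, ENNReal.ofReal_mul (by positivity)]
  exact mul_le_mul' h1 h2

theorem probFar_le [NeZero n] (h : IsCompressionModel P θ N X ℓ γ) (hℓ : 0 < ℓ) (hγ : 0 < γ)
    {s : ℝ} (hs : 0 < s) (hmean : 1 ≤ meanScale n ℓ γ s) {r ε : ℝ} (hr : 0 < r) (hε : 0 < ε)
    (hgr : (n - 1 : ℝ) ≤ (1 - ε) * (cellRate n γ * r)) :
    probFar P θ N X ℓ r ≤ ENNReal.ofReal
      (2 * 4 ^ n * (n / (ε * (cellRate n γ * r)) * meanScale n ℓ γ r)) := by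
  have hg : 0 < cellRate n γ := by
    have := halfMean_pos (n := n)
    unfold cellRate
    positivity
  refine (palm_cond_le h hℓ hγ hs hmean measurableSet_ball.compl
    (fun ω hω => mem_otherDataEvent_of_le_farthest h hr hω.2)
    (lintegral_compl_ball_exp_le hg hr hε hgr)).trans (le_of_eq ?_)
  rw [meanScale]
  congr 1
  ring

theorem probNear_le [NeZero n] (h : IsCompressionModel P θ N X ℓ γ) (hℓ : 0 < ℓ) (hγ : 0 < γ)
    {s : ℝ} (hs : 0 < s) (hmean : 1 ≤ meanScale n ℓ γ s) {r : ℝ} (hr : 0 < r)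
    (hgr : cellRate n γ * r ≤ n - 1) :
    probNear P θ N X ℓ r ≤ ENNReal.ofReal (2 * 4 ^ n * (n * meanScale n ℓ γ r)) := by
  refine (palm_cond_le h hℓ hγ hs hmean measurableSet_closedBall
    (fun ω hω => mem_otherDataEvent_of_farthest_le h hr hω.2
      ((otherDataInZeroCell_eq (N := N) (X := X)) ▸ hω.1))
    (lintegral_closedBall_exp_le hr hgr)).trans (le_of_eq ?_)
  rw [meanScale]
  congr 1
  ring

end Model

/-! ### Exponential rates -/

theorem log_ofReal_exp (x : ℝ) : ENNReal.log (ENNReal.ofReal (Real.exp x)) = x := by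
  rw [ENNReal.log_ofReal_of_pos (Real.exp_pos x), Real.log_exp]

theorem expRate_le_of_le_exp {p : ℕ → ℝ≥0∞} {a : ℕ → ℝ} {L : ℝ}
    (hp : ∀ᶠ n : ℕ in atTop, p n ≤ ENNReal.ofReal (Real.exp (n * a n)))
    (ha : Tendsto a atTop (𝓝 L)) : expRate p ≤ (L : EReal) := by
  have h1 : Tendsto (fun n => (a n : EReal)) atTop (𝓝 (L : EReal)) :=
    (continuous_coe_real_ereal.tendsto L).comp ha
  rw [expRate, ← h1.limsup_eq]
  refine limsup_le_limsup ?_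
  filter_upwards [hp, eventually_ge_atTop 1] with n hn hn1
  have hn0 : (0 : EReal) < n := by exact_mod_cast hn1
  refine (EReal.div_le_iff_le_mul hn0 (EReal.natCast_ne_top n)).2 ?_
  refine (ENNReal.log_monotone hn).trans (le_of_eq ?_)
  rw [log_ofReal_exp]
  push_cast
  rfl

theorem tendsto_zero_of_le_exp {p : ℕ → ℝ≥0∞} {a : ℕ → ℝ} {L : ℝ}
    (hp : ∀ᶠ n : ℕ in atTop, p n ≤ ENNReal.ofReal (Real.exp (n * a n)))
    (ha : Tendsto a atTop (𝓝 L)) (hL : L < 0) : Tendsto p atTop (𝓝 0) := by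
  have h1 : Tendsto (fun n : ℕ => (n : ℝ) * a n) atTop atBot :=
    tendsto_natCast_atTop_atTop.atTop_mul_neg hL ha
  have h2 := ENNReal.tendsto_ofReal (Real.tendsto_exp_atBot.comp h1)
  rw [ENNReal.ofReal_zero] at h2
  exact tendsto_of_tendsto_of_tendsto_of_le_of_le' tendsto_const_nhds h2
    (Eventually.of_forall fun _ => zero_le) hp

/-- Subexponential prefactors `c` do not affect the exponential rate. -/
theorem exists_le_exp {p : ℕ → ℝ≥0∞} {c Φ : ℕ → ℝ} {L : ℝ}
    (hc : ∀ᶠ n in atTop, 0 < c n) (hΦ : ∀ᶠ n in atTop, 0 < Φ n)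
    (hp : ∀ᶠ n : ℕ in atTop, p n ≤ ENNReal.ofReal (2 * 4 ^ n * (c n * Φ n)))
    (hcl : Tendsto (fun n : ℕ => Real.log (c n) / n) atTop (𝓝 0))
    (hΦl : Tendsto (fun n : ℕ => Real.log (Φ n) / n) atTop (𝓝 L)) :
    ∃ a : ℕ → ℝ, (∀ᶠ n : ℕ in atTop, p n ≤ ENNReal.ofReal (Real.exp (n * a n))) ∧
      Tendsto a atTop (𝓝 (L + Real.log 4)) := by
  refine ⟨fun n => Real.log 2 * (1 / n) + Real.log 4 + Real.log (c n) / n + Real.log (Φ n) / n,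
    ?_, ?_⟩
  · filter_upwards [hp, hc, hΦ, eventually_ge_atTop 1] with n h1 h2 h3 h4
    refine h1.trans (le_of_eq ?_)
    have hn : (n : ℝ) ≠ 0 := by positivity
    congr 1
    rw [← Real.exp_log (show 0 < 2 * 4 ^ n * (c n * Φ n) by positivity),
      Real.log_mul (by positivity) (by positivity), Real.log_mul (by positivity) (by positivity),
      Real.log_mul h2.ne' h3.ne', Real.log_pow]
    congr 1
    field_simp
    ring
  · have := (((tendsto_inv_nat.const_mul (Real.log 2)).add_const (Real.log 4)).add hcl).add hΦl
    convert this using 2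
    ring

/-! ### Asymptotics in high dimension -/

section Asymptotic

variable {α lam ρ : ℝ} {γ : ℕ → ℝ}

theorem tendsto_div_rpow (hρ : 0 < ρ) (hγ : γ ~[atTop] fun n : ℕ => ρ * (n : ℝ) ^ α) :
    Tendsto (fun n : ℕ => γ n / (n : ℝ) ^ α) atTop (𝓝 ρ) := by
  have hne : ∀ᶠ n : ℕ in atTop, ρ * (n : ℝ) ^ α ≠ 0 := by
    filter_upwards [eventually_ge_atTop 1] with n hn
    have : (0 : ℝ) < n := by exact_mod_cast hn
    positivity
  have h1 := ((Asymptotics.isEquivalent_iff_tendsto_one hne).1 hγ).const_mul ρ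
  rw [mul_one] at h1
  refine h1.congr' ?_
  filter_upwards [hne] with n hn
  rw [Pi.div_apply]
  have := (mul_ne_zero_iff.1 hn).2
  field_simp

/-- The zero cell lives on the scale `n ^ (3 / 2 - α)`. -/
theorem tendsto_cellRate_mul_div (hρ : 0 < ρ)
    (hγ : γ ~[atTop] fun n : ℕ => ρ * (n : ℝ) ^ α) (R : ℝ) :
    Tendsto (fun n : ℕ => cellRate n (γ n) * (R * (n : ℝ) ^ (3 / 2 - α)) / n) atTop
      (𝓝 (√2 * ρ * R / √Real.pi)) := by
  have h := ((tendsto_div_rpow hρ hγ).const_mul (2 * R)).mul tendsto_halfMean_mul_sqrt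
  have e : 2 * R * ρ * (√(1 / 2) / √Real.pi) = √2 * ρ * R / √Real.pi := by
    have h2 : 2 * √(1 / 2) = √2 := by
      rw [one_div, Real.sqrt_inv, ← div_eq_mul_inv, Real.div_sqrt]
    rw [← h2]
    ring
  rw [e] at h
  refine h.congr' ?_
  filter_upwards [eventually_ge_atTop 1] with n hn
  have hn' : (0 : ℝ) < n := by exact_mod_cast hn
  have h3 : (n : ℝ) ^ (3 / 2 - α) = √n * n / (n : ℝ) ^ α := by
    rw [Real.rpow_sub hn', Real.sqrt_eq_rpow, ← Real.rpow_add_one hn'.ne']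
    norm_num
  have h4 : (n : ℝ) ^ α ≠ 0 := (Real.rpow_pos_of_pos hn' α).ne'
  rw [h3, cellRate]
  field_simp

theorem dataIntensity_pos {n : ℕ} (hn : 1 ≤ n) : 0 < dataIntensity α lam n := by
  have : (0 : ℝ) < n := by exact_mod_cast hn
  unfold dataIntensity
  positivity

/-- The exponential rate of the mean number of data points of the zero cell at distance about
`R n ^ (3 / 2 - α)` from the origin. -/
theorem tendsto_log_meanScale (hρ : 0 < ρ)
    (hγ : γ ~[atTop] fun n : ℕ => ρ * (n : ℝ) ^ α) {R : ℝ} (hR : 0 < R) :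
    Tendsto (fun n : ℕ => Real.log (meanScale n (dataIntensity α lam n) (γ n)
        (R * (n : ℝ) ^ (3 / 2 - α))) / n) atTop
      (𝓝 (lam + 1 / 2 * Real.log (2 * Real.pi * Real.exp 1) + Real.log R
        - √2 * ρ * R / √Real.pi)) := by
  have h := ((tendsto_log_ballVolume.const_add lam).add_const (Real.log R)).sub
    (tendsto_cellRate_mul_div hρ hγ R)
  refine h.congr' ?_
  filter_upwards [eventually_ge_atTop 1] with n hn
  have hn' : (0 : ℝ) < n := by exact_mod_cast hn
  have hb := ballVolume_pos n
  have hr : 0 < R * (n : ℝ) ^ (3 / 2 - α) := by positivity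
  have hℓ : Real.log (dataIntensity α lam n) = n * (α - 1) * Real.log n + n * lam := by
    rw [dataIntensity, Real.log_mul (by positivity) (by positivity), Real.log_rpow hn',
      Real.log_exp]
  rw [meanScale, Real.log_mul (dataIntensity_pos hn).ne' (by positivity),
    Real.log_mul (by positivity) (by positivity), Real.log_mul (by positivity) (by positivity),
    Real.log_exp, Real.log_pow, hℓ, Real.log_mul hR.ne' (by positivity), Real.log_rpow hn']
  field_simp
  ring

/-- Below the critical intensity `rhoStar`, the mean number of data points of the zero cell at
the optimal distance from the origin grows exponentially. -/
theorem eventually_one_le_meanScale (hρ : 0 < ρ) (hρ' : ρ < rhoStar lam)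
    (hγ : γ ~[atTop] fun n : ℕ => ρ * (n : ℝ) ^ α) :
    ∀ᶠ n : ℕ in atTop, 1 ≤ meanScale n (dataIntensity α lam n) (γ n)
      (√Real.pi / (√2 * ρ) * (n : ℝ) ^ (3 / 2 - α)) := by
  have hπ := Real.pi_pos
  have hR : 0 < √Real.pi / (√2 * ρ) := by positivity
  have h := tendsto_log_meanScale (lam := lam) hρ hγ hR
  have e : lam + 1 / 2 * Real.log (2 * Real.pi * Real.exp 1) + Real.log (√Real.pi / (√2 * ρ))
      - √2 * ρ * (√Real.pi / (√2 * ρ)) / √Real.pi = Real.log (rhoStar lam) - Real.log ρ := by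
    have e1 : √2 * ρ * (√Real.pi / (√2 * ρ)) / √Real.pi = 1 := by
      have := Real.sqrt_pos.2 hπ
      have : √(2 : ℝ) ≠ 0 := by positivity
      field_simp
    rw [e1, rhoStar, Real.log_mul (by positivity) (by positivity),
      Real.log_mul (by positivity) (by positivity), Real.log_div (by positivity) (by positivity),
      Real.log_div (by positivity) (by positivity), Real.log_mul (by positivity) (by positivity),
      Real.log_mul (by positivity) (by positivity), Real.log_sqrt (by positivity),
      Real.log_sqrt (by positivity), Real.log_sqrt (by positivity), Real.log_exp, Real.log_exp]
    ring
  rw [e] at h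
  have hpos : 0 < Real.log (rhoStar lam) - Real.log ρ := sub_pos.2 (Real.log_lt_log hρ hρ')
  filter_upwards [h.eventually (lt_mem_nhds hpos), eventually_ge_atTop 1] with n hn hn1
  have hn' : (0 : ℝ) < n := by exact_mod_cast hn1
  have h1 := (div_pos_iff_of_pos_right hn').1 hn
  exact ((Real.log_pos_iff (meanScale_pos (dataIntensity_pos hn1) (by positivity)).le).1 h1).le

variable {Ω : ℕ → Type*} [∀ n, MeasurableSpace (Ω n)] {P : ∀ n, Measure (Ω n)}
  {θ : ∀ n, E n → Ω n → Ω n} {N : ∀ n, Ω n → Measure (E n)}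
  {X : ∀ n, Ω n → Measure (Hyperplane n)}

/-- Beyond the optimal distance, the probability that the farthest data point of the zero cell is
far away is exponentially bounded. -/
theorem probFar_exists_le_exp (hρ : 0 < ρ) (hρ' : ρ < rhoStar lam) (hγ0 : ∀ n, 1 ≤ n → 0 < γ n)
    (hγ : γ ~[atTop] fun n : ℕ => ρ * (n : ℝ) ^ α)
    (h : ∀ n, 1 ≤ n →
      IsCompressionModel (P n) (θ n) (N n) (X n) (dataIntensity α lam n) (γ n))
    {R : ℝ} (hR : 0 < R) (hρR : √Real.pi / (R * √2) < ρ) :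
    ∃ a : ℕ → ℝ, (∀ᶠ n : ℕ in atTop, probFar (P n) (θ n) (N n) (X n) (dataIntensity α lam n)
        (R * (n : ℝ) ^ (3 / 2 - α)) ≤ ENNReal.ofReal (Real.exp (n * a n))) ∧
      Tendsto a atTop (𝓝 (lam + 1 / 2 * Real.log (2 * Real.pi * Real.exp 1) + Real.log R
        - √2 * ρ * R / √Real.pi + Real.log 4)) := by
  have hπ := Real.sqrt_pos.2 Real.pi_pos
  set c := √2 * ρ * R / √Real.pi with hc
  have hc1 : 1 < c := by
    rw [div_lt_iff₀ (by positivity)] at hρR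
    rw [hc, one_lt_div hπ]
    linarith
  -- This choice of `ε` gives `1 < (1 - ε) * c`.
  obtain ⟨ε, hε, hεc⟩ : ∃ ε : ℝ, 0 < ε ∧ 1 < (1 - ε) * c := by
    refine ⟨(c - 1) / (2 * c), by have := sub_pos.2 hc1; positivity, ?_⟩
    have : (1 - (c - 1) / (2 * c)) * c = (c + 1) / 2 := by field_simp; ring
    rw [this]
    linarith
  have hgr := tendsto_cellRate_mul_div hρ hγ R
  have hgrpos := hgr.eventually (lt_mem_nhds (zero_lt_one.trans hc1))
  refine exists_le_exp (c := fun n => n / (ε * (cellRate n (γ n) * (R * (n : ℝ) ^ (3 / 2 - α)))))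
    (Φ := fun n => meanScale n (dataIntensity α lam n) (γ n) (R * (n : ℝ) ^ (3 / 2 - α)))
    ?_ ?_ ?_ ?_ (tendsto_log_meanScale hρ hγ hR)
  · filter_upwards [hgrpos, eventually_ge_atTop 1] with n hn hn1
    have hn' : (0 : ℝ) < n := by exact_mod_cast hn1
    have := (div_pos_iff_of_pos_right hn').1 hn
    positivity
  · filter_upwards [eventually_ge_atTop 1] with n hn
    have hn' : (0 : ℝ) < n := by exact_mod_cast hn
    exact meanScale_pos (dataIntensity_pos hn) (by positivity)
  · filter_upwards [eventually_one_le_meanScale hρ hρ' hγ, eventually_ge_atTop 1,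
      (hgr.const_mul (1 - ε)).eventually (lt_mem_nhds hεc)] with n h1 hn h2
    have : NeZero n := ⟨by omega⟩
    have hn' : (0 : ℝ) < n := by exact_mod_cast hn
    refine probFar_le (h n hn) (dataIntensity_pos hn) (hγ0 n hn) (by positivity) h1
      (by positivity) hε ?_
    rw [← mul_div_assoc, lt_div_iff₀ hn'] at h2
    linarith
  · have h1 : Tendsto (fun n : ℕ => Real.log (ε * (cellRate n (γ n) *
        (R * (n : ℝ) ^ (3 / 2 - α)) / n))) atTop (𝓝 (Real.log (ε * c))) :=
      (hgr.const_mul ε).log (by positivity)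
    have h2 := (h1.mul tendsto_inv_nat).neg
    rw [mul_zero, neg_zero] at h2
    refine h2.congr fun n => ?_
    rw [← mul_div_assoc, ← inv_div (ε * _), Real.log_inv]
    ring_nf

/-- Below the optimal distance, the probability that the farthest data point of the zero cell is
close to the origin is exponentially bounded. -/
theorem probNear_exists_le_exp (hρ : 0 < ρ) (hρ' : ρ < rhoStar lam) (hγ0 : ∀ n, 1 ≤ n → 0 < γ n)
    (hγ : γ ~[atTop] fun n : ℕ => ρ * (n : ℝ) ^ α)
    (h : ∀ n, 1 ≤ n →
      IsCompressionModel (P n) (θ n) (N n) (X n) (dataIntensity α lam n) (γ n))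
    {R : ℝ} (hR : 0 < R) (hρR : ρ < √Real.pi / (R * √2)) :
    ∃ a : ℕ → ℝ, (∀ᶠ n : ℕ in atTop, probNear (P n) (θ n) (N n) (X n) (dataIntensity α lam n)
        (R * (n : ℝ) ^ (3 / 2 - α)) ≤ ENNReal.ofReal (Real.exp (n * a n))) ∧
      Tendsto a atTop (𝓝 (lam + 1 / 2 * Real.log (2 * Real.pi * Real.exp 1) + Real.log R
        - √2 * ρ * R / √Real.pi + Real.log 4)) := by
  have hπ := Real.sqrt_pos.2 Real.pi_pos
  have hc1 : √2 * ρ * R / √Real.pi < 1 := by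
    rw [lt_div_iff₀ (by positivity)] at hρR
    rw [div_lt_one hπ]
    linarith
  have hgr : Tendsto (fun n : ℕ => cellRate n (γ n) * (R * (n : ℝ) ^ (3 / 2 - α)) / n + 1 / n)
      atTop (𝓝 (√2 * ρ * R / √Real.pi)) := by
    have := (tendsto_cellRate_mul_div hρ hγ R).add tendsto_inv_nat
    rwa [add_zero] at this
  refine exists_le_exp (c := fun n => n)
    (Φ := fun n => meanScale n (dataIntensity α lam n) (γ n) (R * (n : ℝ) ^ (3 / 2 - α)))
    ?_ ?_ ?_ tendsto_log_div_nat (tendsto_log_meanScale hρ hγ hR)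
  · filter_upwards [eventually_ge_atTop 1] with n hn
    exact_mod_cast hn
  · filter_upwards [eventually_ge_atTop 1] with n hn
    have hn' : (0 : ℝ) < n := by exact_mod_cast hn
    exact meanScale_pos (dataIntensity_pos hn) (by positivity)
  · filter_upwards [eventually_one_le_meanScale hρ hρ' hγ, eventually_ge_atTop 1,
      hgr.eventually (gt_mem_nhds hc1)] with n h1 hn h2
    have : NeZero n := ⟨by omega⟩
    have hn' : (0 : ℝ) < n := by exact_mod_cast hn
    refine probNear_le (h n hn) (dataIntensity_pos hn) (hγ0 n hn) (by positivity) h1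
      (by positivity) ?_
    rw [← add_div, div_lt_one hn'] at h2
    linarith

end Asymptotic

/-! ### Thresholds -/

theorem div_lt_rhoStar {lam R : ℝ} (hR : √(Real.exp 1) / (Real.exp lam * √(2 * Real.pi)) < R) :
    √Real.pi / (R * √2) < rhoStar lam := by
  have hπ := Real.pi_pos
  have hR0 : 0 < R := lt_trans (by positivity) hR
  rw [div_lt_iff₀ (by positivity), Real.sqrt_mul zero_le_two] at hR
  have hs := Real.sq_sqrt hπ.le
  rw [rhoStar, div_lt_div_iff₀ (by positivity) (by positivity)]
  have := mul_lt_mul_of_pos_left hR (Real.sqrt_pos.2 hπ)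
  calc _ < _ := this
    _ = Real.exp lam * √Real.pi ^ 2 * (R * √2) := by ring
    _ = _ := by rw [hs]

theorem eventually_rhoUpper_lt (lam : ℝ) : ∀ᶠ R : ℝ in atTop, rhoUpper lam R < rhoStar lam := by
  have hπ := Real.pi_pos
  have hstar : 0 < rhoStar lam := by unfold rhoStar; positivity
  have hlog : Tendsto (fun R : ℝ => Real.log R / R) atTop (𝓝 0) :=
    Real.isLittleO_log_id_atTop.tendsto_div_nhds_zero
  have hinv : Tendsto (fun R : ℝ => R⁻¹) atTop (𝓝 0) := tendsto_inv_atTop_zero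
  set K := lam + 1 / 2 * Real.log (2 * Real.pi * Real.exp 1) + Real.log 4 with hK
  have h1 : Tendsto (fun R : ℝ => √Real.pi / √2 * (K * R⁻¹ + Real.log R / R)) atTop (𝓝 0) := by
    have := ((hinv.const_mul K).add hlog).const_mul (√Real.pi / √2)
    simpa using this
  have h2 : Tendsto (fun R : ℝ => √Real.pi / √2 * R⁻¹) atTop (𝓝 0) := by
    simpa using hinv.const_mul (√Real.pi / √2)
  filter_upwards [h1.eventually (gt_mem_nhds hstar), h2.eventually (gt_mem_nhds hstar),
    eventually_gt_atTop 0] with R h3 h4 hR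
  rw [rhoUpper, mul_max_of_nonneg _ _ (by positivity), max_lt_iff]
  constructor
  · refine lt_of_eq_of_lt ?_ h3
    rw [hK]
    field_simp
    ring
  · refine lt_of_eq_of_lt ?_ h4
    field_simp

theorem half_log_eq {R : ℝ} (hR : 0 < R) :
    1 / 2 * Real.log (32 * Real.pi * Real.exp 1 * R ^ 2) =
      1 / 2 * Real.log (2 * Real.pi * Real.exp 1) + Real.log R + Real.log 4 := by
  have e : 32 * Real.pi * Real.exp 1 * R ^ 2 = 2 * Real.pi * Real.exp 1 * (R * 4) ^ 2 := by ring
  have hπ := Real.pi_pos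
  rw [e, Real.log_mul (by positivity) (by positivity), Real.log_pow,
    Real.log_mul hR.ne' (by norm_num)]
  push_cast
  ring

end PoissonCompression

open PoissonCompression
theorem theoremt (α lam : ℝ) :
    -- the two claims on thresholds made in (i) and (ii)
    (∀ R : ℝ, √(Real.exp 1) / (Real.exp lam * √(2 * Real.pi)) < R →
      √Real.pi / (R * √2) < rhoStar lam) ∧
    (∀ᶠ R : ℝ in atTop, rhoUpper lam R < rhoStar lam) ∧
    ∀ (ρ : ℝ) (γ : ℕ → ℝ) (Ω : ℕ → Type*) [∀ n, MeasurableSpace (Ω n)]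
      (P : ∀ n, Measure (Ω n)) (θ : ∀ n, E n → Ω n → Ω n) (N : ∀ n, Ω n → Measure (E n))
      (X : ∀ n, Ω n → Measure (Hyperplane n)),
      0 < ρ → ρ < rhoStar lam →
      (∀ n, 1 ≤ n → 0 < γ n) →
      (γ ~[atTop] fun n : ℕ => ρ * (n : ℝ) ^ α) →
      (∀ n, 1 ≤ n →
        IsCompressionModel (P n) (θ n) (N n) (X n) (dataIntensity α lam n) (γ n)) →
      ∀ R : ℝ, 0 < R →
        -- (i)
        (√(Real.exp 1) / (Real.exp lam * √(2 * Real.pi)) < R → √Real.pi / (R * √2) < ρ →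
          expRate (fun n => probFar (P n) (θ n) (N n) (X n) (dataIntensity α lam n)
              (R * (n : ℝ) ^ (3 / 2 - α))) ≤
            ((lam + 1 / 2 * Real.log (2 * Real.pi * Real.exp 1) + Real.log R
              - √2 * ρ * R / √Real.pi + Real.log 4 : ℝ) : EReal)) ∧
        -- (ii)
        (rhoUpper lam R < rhoStar lam → rhoUpper lam R < ρ →
          Tendsto (fun n => probFar (P n) (θ n) (N n) (X n) (dataIntensity α lam n)
              (R * (n : ℝ) ^ (3 / 2 - α))) atTop (𝓝 0) ∧
          expRate (fun n => probFar (P n) (θ n) (N n) (X n) (dataIntensity α lam n)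
              (R * (n : ℝ) ^ (3 / 2 - α))) ≤
            ((lam + 1 / 2 * Real.log (32 * Real.pi * Real.exp 1 * R ^ 2)
              - √2 * ρ * R / √Real.pi : ℝ) : EReal) ∧
          lam + 1 / 2 * Real.log (32 * Real.pi * Real.exp 1 * R ^ 2)
            - √2 * ρ * R / √Real.pi < 0) ∧
        -- (iii)
        (ρ < min (√Real.pi / (R * √2)) (rhoStar lam) →
          expRate (fun n => probNear (P n) (θ n) (N n) (X n) (dataIntensity α lam n)
              (R * (n : ℝ) ^ (3 / 2 - α))) ≤
            ((lam + 1 / 2 * Real.log (2 * Real.pi * Real.exp 1) + Real.log R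
              - √2 * ρ * R / √Real.pi + Real.log 4 : ℝ) : EReal)) ∧
        -- (iv)
        (R < (4 * Real.exp lam * √(2 * Real.pi * Real.exp 1))⁻¹ →
          ρ < min (√Real.pi / (R * √2)) (rhoStar lam) →
          Tendsto (fun n => probNear (P n) (θ n) (N n) (X n) (dataIntensity α lam n)
              (R * (n : ℝ) ^ (3 / 2 - α))) atTop (𝓝 0) ∧
          expRate (fun n => probNear (P n) (θ n) (N n) (X n) (dataIntensity α lam n)
              (R * (n : ℝ) ^ (3 / 2 - α))) ≤
            ((lam + 1 / 2 * Real.log (32 * Real.pi * Real.exp 1 * R ^ 2)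
              - √2 * ρ * R / √Real.pi : ℝ) : EReal) ∧
          lam + 1 / 2 * Real.log (32 * Real.pi * Real.exp 1 * R ^ 2)
            - √2 * ρ * R / √Real.pi < 0) := by 
  have hπ := Real.sqrt_pos.2 Real.pi_pos
  refine ⟨fun R hR => div_lt_rhoStar hR, eventually_rhoUpper_lt lam, ?_⟩
  intro ρ γ Ω _ P θ N X hρ hρ' hγ0 hγ h R hR
  have hrate : lam + 1 / 2 * Real.log (32 * Real.pi * Real.exp 1 * R ^ 2)
      - √2 * ρ * R / √Real.pi =
      lam + 1 / 2 * Real.log (2 * Real.pi * Real.exp 1) + Real.log R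
        - √2 * ρ * R / √Real.pi + Real.log 4 := by
    rw [half_log_eq hR]
    ring
  rw [hrate]
  refine ⟨fun _ hρR => ?_, fun _ hρu => ?_, fun hρR => ?_, fun hRs hρR => ?_⟩
  · obtain ⟨a, ha, hlim⟩ := probFar_exists_le_exp hρ hρ' hγ0 hγ h hR hρR
    exact expRate_le_of_le_exp ha hlim
  · rw [rhoUpper, div_mul_eq_mul_div, div_lt_iff₀ (by positivity)] at hρu
    have hneg : lam + 1 / 2 * Real.log (2 * Real.pi * Real.exp 1) + Real.log R
        - √2 * ρ * R / √Real.pi + Real.log 4 < 0 := by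
      have h1 : √Real.pi * (lam + 1 / 2 * Real.log (2 * Real.pi * Real.exp 1) + Real.log R
          + Real.log 4) < ρ * (R * √2) :=
        (mul_le_mul_of_nonneg_left (le_max_left _ _) hπ.le).trans_lt hρu
      have h2 : lam + 1 / 2 * Real.log (2 * Real.pi * Real.exp 1) + Real.log R
          + Real.log 4 < √2 * ρ * R / √Real.pi := by
        rw [lt_div_iff₀ hπ]
        linarith
      linarith
    have hρR : √Real.pi / (R * √2) < ρ := by
      rw [div_lt_iff₀ (by positivity)]
      refine lt_of_le_of_lt ?_ hρu
      exact le_mul_of_one_le_right hπ.le (le_max_right _ _)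
    obtain ⟨a, ha, hlim⟩ := probFar_exists_le_exp hρ hρ' hγ0 hγ h hR hρR
    exact ⟨tendsto_zero_of_le_exp ha hlim hneg, expRate_le_of_le_exp ha hlim, hneg⟩
  · obtain ⟨a, ha, hlim⟩ :=
      probNear_exists_le_exp hρ hρ' hγ0 hγ h hR (hρR.trans_le (min_le_left _ _))
    exact expRate_le_of_le_exp ha hlim
  · have hneg : lam + 1 / 2 * Real.log (2 * Real.pi * Real.exp 1) + Real.log R
        - √2 * ρ * R / √Real.pi + Real.log 4 < 0 := by
      have h1 := Real.log_lt_log hR hRs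
      rw [Real.log_inv, Real.log_mul (by positivity) (by positivity),
        Real.log_mul (by positivity) (by positivity), Real.log_exp,
        Real.log_sqrt (by positivity)] at h1
      have h2 : 0 < √2 * ρ * R / √Real.pi := by positivity
      linarith
    obtain ⟨a, ha, hlim⟩ :=
      probNear_exists_le_exp hρ hρ' hγ0 hγ h hR (hρR.trans_le (min_le_left _ _))
    exact ⟨tendsto_zero_of_le_exp ha hlim hneg, expRate_le_of_le_exp ha hlim, hneg⟩
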